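/- Let $\Bbbk$ be a field of characteristic $0$ and let $\hbar$ be a formal variable of degree $0$. **MV-algebras.** An *MV-algebra over $\Bbbk[[\hbar]]$* is $V=(V,\mu,\delta,\Delta)$, where $V$ is a $\mathbb Z$-graded $\Bbbk$-vector space, $(V,\mu)$ is a unital graded commutative associative $\Bbbk$-algebra, $(V,\delta)$ is a conilpotent counital graded cocommutative coassociative $\Bbbk$-coalgebra, the unit $\Bbbk\to V$ is a coaugmentation of $(V,\delta)$, the counit $V\to\Bbbk$ is an augmentation of $(V,\mu)$, and $\Delta:V[[\hbar]]\to V[[\hbar]]$ is a $\Bbbk[[\hbar]]$-linear map of degree $1$ with $\Delta^2=0$ and $\Delta(1)=0$. (No compatibility between $\mu$ and $\delta$ is required.) For MV-algebras $V',V''$, the degree $0$ $\Bbbk[[\hbar]]$-linear maps $V'[[\hbar]]\to V''[[\hbar]]$ form an algebra under the convolution product $f\star g=\mu''\circ(f\otimes g)\circ\delta'$, with unit $\mathsf e$ (the counit followed by the unit). Let $\mathrm{Lin}^0(V',V'')$ be the set of those $f$ with $f(1)\in\hbar V''[[\hbar]]$. For $f,g\in\mathrm{Lin}^0(V',V'')$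 the convergent series $$\exp f=\mathsf e+f+\tfrac1{2!}f^{\star2}+\cdots,\qquad \log(\mathsf e+g)=g-\tfrac12g^{\star2}+\tfrac13g^{\star3}-\cdots$$ are formed with respect to $\star$. The category $\mathtt{MV}_{\Bbbk[[\hbar]]}$ has the MV-algebras over $\Bbbk[[\hbar]]$ as objects; a morphism $V'\to V''$ is an $f\in\mathrm{Lin}^0(V',V'')$ with $\Delta''\circ\exp f=\exp f\circ\Delta'$; the composition is $f\diamond g=\log(\exp f\circ\exp g)$, and the identity of $V$ is $\log(\mathrm{id}_{V[[\hbar]]})$. **$\mathrm{IBL}_\infty$-algebras.** An *$\mathrm{IBL}_\infty$-algebra* is a graded vector space $U$ with a degree $1$ $\Bbbk[[\hbar]]$-linear map $\Delta=\Delta_1+\hbar\Delta_2+\hbar^2\Delta_3+\cdots$ on $S(U)[[\hbar]]$ such that $\Delta^2=0$, $\Delta(1)=0$ and each $\Delta_k:S(U)\to S(U)$ is a differential operator of order $\le k$ (its graded commutators with any $k+1$ left multiplications vanish), where $S(U)$ is the graded symmetric algebra. With the standard bialgebra structure of $S(U)$ it is an MV-algebra over $\Bbbk[[\hbar]]$.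 An *$\mathrm{IBL}_\infty$-morphism* from $(U',\Delta')$ to $(U'',\Delta'')$ is a morphism $f:S(U')[[\hbar]]\to S(U'')[[\hbar]]$ of $\mathtt{MV}_{\Bbbk[[\hbar]]}$ such that, writing $$f=f^{(1)}+\hbar f^{(2)}+\hbar^2f^{(3)}+\cdots,\qquad f^{(k)}:S(U')\to S(U''),$$ one has $f^{(1)}(1)=0$, and $f^{(k)}$ vanishes on $S^n(U')$ for all $k\ge1$ and $n>k$. **Corollary.** $\mathrm{IBL}_\infty$-algebras and $\mathrm{IBL}_\infty$-morphisms form a subcategory of $\mathtt{MV}_{\Bbbk[[\hbar]]}$. That is, for each $\mathrm{IBL}_\infty$-algebra its identity morphism in $\mathtt{MV}_{\Bbbk[[\hbar]]}$ is an $\mathrm{IBL}_\infty$-morphism, and whenever $g$ and $f$ are composable $\mathrm{IBL}_\infty$-morphisms, their composition $f\diamond g=\log(\exp f\circ\exp g)$ in $\mathtt{MV}_{\Bbbk[[\hbar]]}$ is an $\mathrm{IBL}_\infty$-morphism. -/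

import Mathlib

open PowerSeries TensorProduct WithConv

noncomputable section

universe u v w

namespace MVAlgebra

section Series

variable {k : Type u} [Field k] {V : Type v} [Ring V] [Algebra k V] {W : Type w} [Ring W]
  [Algebra k W]

/-- `V⟦X⟧`, the completed tensor product of `V` with `k⟦X⟧` (where `X` is `ℏ`), is a module over
`k⟦X⟧`.  The algebra `V` need not be commutative. -/
instance (priority := 10) seriesModule : Module k⟦X⟧ V⟦X⟧ :=
  Module.compHom V⟦X⟧ (PowerSeries.map (algebraMap k V))

theorem series_smul_def (p : k⟦X⟧) (x : V⟦X⟧) :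
    p • x = PowerSeries.map (algebraMap k V) p * x := rfl

theorem coeff_series_smul (p : k⟦X⟧) (x : V⟦X⟧) (n : ℕ) :
    coeff n (p • x) = ∑ q ∈ Finset.HasAntidiagonal.antidiagonal n, coeff q.1 p • coeff q.2 x := by
  rw [series_smul_def, coeff_mul]
  refine Finset.sum_congr rfl fun q _ => ?_
  rw [coeff_map, Algebra.smul_def]

theorem C_smul_series (a : k) (x : V⟦X⟧) : (C a : k⟦X⟧) • x = a • x := by
  ext n
  rw [series_smul_def, map_C, coeff_C_mul, PowerSeries.coeff_smul, Algebra.smul_def]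

/-- The restriction to `V` of a `k⟦X⟧`-linear map `V⟦X⟧ → W⟦X⟧`. -/
def restr (F : V⟦X⟧ →ₗ[k⟦X⟧] W⟦X⟧) : V →ₗ[k] W⟦X⟧ where
  toFun v := F (C v)
  map_add' a b := by rw [map_add, map_add]
  map_smul' a b := by
    rw [RingHom.id_apply, ← C_smul_series, ← map_smul, C_smul_series]
    congr 1
    ext n
    rw [PowerSeries.coeff_smul, coeff_C, coeff_C]
    split_ifs <;> simp

theorem restr_apply (F : V⟦X⟧ →ₗ[k⟦X⟧] W⟦X⟧) (v : V) : restr F v = F (C v) := rfl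

/-- The `k⟦X⟧`-linear extension `V⟦X⟧ → W⟦X⟧` of a `k`-linear map `V → W⟦X⟧`. -/
def extend (φ : V →ₗ[k] W⟦X⟧) : V⟦X⟧ →ₗ[k⟦X⟧] W⟦X⟧ where
  toFun x := PowerSeries.mk fun n =>
    ∑ q ∈ Finset.HasAntidiagonal.antidiagonal n, coeff q.1 (φ (coeff q.2 x))
  map_add' x y := by
    ext n
    simp [Finset.sum_add_distrib]
  map_smul' p x := by
    ext n
    simp only [coeff_mk, coeff_series_smul, map_sum, map_smul, RingHom.id_apply,
      PowerSeries.coeff_smul, Finset.smul_sum]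
    rw [Finset.sum_sigma', Finset.sum_sigma']
    refine Finset.sum_bij' (fun s _ => ⟨(s.2.1, s.1.1 + s.2.2), (s.1.1, s.2.2)⟩)
      (fun s _ => ⟨(s.2.1, s.1.1 + s.2.2), (s.1.1, s.2.2)⟩) ?_ ?_ ?_ ?_ ?_ <;>
    rintro ⟨⟨a, b⟩, ⟨c, d⟩⟩ h <;>
    simp only [Finset.mem_sigma, Finset.HasAntidiagonal.mem_antidiagonal] at h ⊢
    · exact ⟨by omega, trivial⟩
    · exact ⟨by omega, trivial⟩
    · obtain ⟨h1, rfl⟩ := h; rfl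
    · obtain ⟨h1, rfl⟩ := h; rfl

theorem coeff_extend (φ : V →ₗ[k] W⟦X⟧) (x : V⟦X⟧) (n : ℕ) :
    coeff n (extend φ x) = ∑ q ∈ Finset.HasAntidiagonal.antidiagonal n, coeff q.1 (φ (coeff q.2 x)) :=
  coeff_mk n fun n => ∑ q ∈ Finset.HasAntidiagonal.antidiagonal n, coeff q.1 (φ (coeff q.2 x))

theorem restr_extend (φ : V →ₗ[k] W⟦X⟧) : restr (extend φ) = φ := by
  ext v n
  rw [restr_apply, coeff_extend, Finset.sum_eq_single (n, 0)]
  · simp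
  · rintro ⟨a, b⟩ h hne
    have hb : b ≠ 0 := by
      rintro rfl
      exact hne (by simpa using h)
    simp [coeff_C, hb]
  · simp

theorem coeff_apply_eq (F : V⟦X⟧ →ₗ[k⟦X⟧] W⟦X⟧) (N : ℕ) : ∀ (n : ℕ) (x : V⟦X⟧), n < N →
    coeff n (F x) = ∑ q ∈ Finset.HasAntidiagonal.antidiagonal n, coeff q.1 (F (C (coeff q.2 x))) := by
  induction N with
  | zero => intro n x h; omega
  | succ N ih =>
    intro n x h
    let y : V⟦X⟧ := PowerSeries.mk fun m => coeff (m + 1) x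
    have hx : x = C (coeff 0 x) + (X : k⟦X⟧) • y := by
      ext m
      rw [series_smul_def, map_X, map_add]
      cases m with
      | zero => simp
      | succ m => simp [y, coeff_succ_X_mul]
    have h2 : F x = F (C (coeff 0 x)) + (X : k⟦X⟧) • F y := by
      conv_lhs => rw [hx, map_add, map_smul]
    rw [h2, series_smul_def, map_X, map_add]
    cases n with
    | zero => simp
    | succ n =>
      rw [coeff_succ_X_mul, ih n y (by omega), Finset.Nat.antidiagonal_succ', Finset.sum_cons,
        Finset.sum_map]
      simp [y]

theorem extend_restr (F : V⟦X⟧ →ₗ[k⟦X⟧] W⟦X⟧) : extend (restr F) = F := by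
  ext x n
  rw [coeff_extend, coeff_apply_eq F (n + 1) n x (by omega)]
  rfl

theorem restr_injective : Function.Injective (restr : (V⟦X⟧ →ₗ[k⟦X⟧] W⟦X⟧) → _) :=
  fun F G h => by rw [← extend_restr F, h, extend_restr]

end Series

section Convolution

variable {k : Type u} [Field k] {V : Type v} [Ring V] [Algebra k V] [Coalgebra k V]
  {W : Type w} [Ring W] [Algebra k W]

/-- `φ` is topologically nilpotent for the convolution product: its convolution powers tend
pointwise to zero in the `X`-adic topology. -/
def TopNilp (φ : WithConv (V →ₗ[k] W⟦X⟧)) : Prop :=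
  ∀ (v : V) (N : ℕ), ∃ K, ∀ m ≥ K, ∀ n < N, coeff n ((φ ^ m) v) = 0

theorem TopNilp.finite {φ : WithConv (V →ₗ[k] W⟦X⟧)} (h : TopNilp φ) (p : k⟦X⟧) (v : V) (n : ℕ) :
    (Function.support fun m => coeff m p • coeff n ((φ ^ m) v)).Finite := by
  obtain ⟨K, hK⟩ := h v (n + 1)
  refine (Set.finite_lt_nat K).subset fun m hm => ?_
  by_contra hlt
  exact hm (by simp [hK m (not_lt.mp hlt) n (by omega)])

/-- The convergent sum `∑ pₘ φ^m` (convolution powers, `X`-adic convergence at every `v`) of a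
power series `p` in a topologically nilpotent `φ`. -/
def evalSeries (p : k⟦X⟧) (φ : WithConv (V →ₗ[k] W⟦X⟧)) (h : TopNilp φ) :
    WithConv (V →ₗ[k] W⟦X⟧) :=
  toConv
  { toFun := fun v => PowerSeries.mk fun n => ∑ᶠ m, coeff m p • coeff n ((φ ^ m) v)
    map_add' := fun a b => by
      ext n
      simp only [coeff_mk, map_add, smul_add]
      exact finsum_add_distrib (h.finite p a n) (h.finite p b n)
    map_smul' := fun c a => by
      ext n
      simp only [coeff_mk, map_smul, PowerSeries.coeff_smul, RingHom.id_apply]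
      rw [smul_finsum' c (h.finite p a n)]
      exact finsum_congr fun m => smul_comm _ _ _ }

theorem coeff_evalSeries (p : k⟦X⟧) (φ : WithConv (V →ₗ[k] W⟦X⟧)) (h : TopNilp φ) (v : V) (n : ℕ) :
    coeff n (evalSeries p φ h v) = ∑ᶠ m, coeff m p • coeff n ((φ ^ m) v) :=
  coeff_mk n fun n => ∑ᶠ m, coeff m p • coeff n ((φ ^ m) v)

theorem coeff_evalSeries_eq_sum (p : k⟦X⟧) {φ : WithConv (V →ₗ[k] W⟦X⟧)} (h : TopNilp φ) (v : V)
    (n K : ℕ) (hK : ∀ m ≥ K, coeff n ((φ ^ m) v) = 0) :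
    coeff n (evalSeries p φ h v) = ∑ m ∈ Finset.range K, coeff m p • coeff n ((φ ^ m) v) := by
  rw [coeff_evalSeries]
  refine finsum_eq_sum_of_support_subset _ fun m hm => ?_
  by_contra hlt
  rw [Finset.mem_coe, Finset.mem_range, not_lt] at hlt
  exact hm (by simp [hK m hlt])

theorem coeff_aeval_apply {φ : WithConv (V →ₗ[k] W⟦X⟧)} (r : Polynomial k) (v : V) (n K : ℕ)
    (hK : ∀ m ≥ K, coeff n ((φ ^ m) v) = 0) :
    coeff n ((Polynomial.aeval φ r) v) =
      ∑ m ∈ Finset.range K, r.coeff m • coeff n ((φ ^ m) v) := by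
  have h1 : coeff n ((Polynomial.aeval φ r) v) =
      ∑ m ∈ Finset.range (max (r.natDegree + 1) K), r.coeff m • coeff n ((φ ^ m) v) := by
    rw [Polynomial.aeval_eq_sum_range' (n := max (r.natDegree + 1) K) (by simp)]
    simp [LinearMap.sum_apply]
  rw [h1]
  symm
  refine Finset.sum_subset ?_ fun m _ hm => ?_
  · intro m hm
    simp only [Finset.mem_range] at hm ⊢
    exact lt_max_of_lt_right hm
  · rw [Finset.mem_range, not_lt] at hm
    rw [hK m hm, smul_zero]

theorem coeff_evalSeries_eq_aeval (p : k⟦X⟧) {φ : WithConv (V →ₗ[k] W⟦X⟧)} (h : TopNilp φ) (v : V)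
    (n K : ℕ) (hK : ∀ m ≥ K, coeff n ((φ ^ m) v) = 0) :
    coeff n (evalSeries p φ h v) = coeff n ((Polynomial.aeval φ (trunc K p)) v) := by
  rw [coeff_evalSeries_eq_sum p h v n K hK, coeff_aeval_apply _ v n K hK]
  refine Finset.sum_congr rfl fun m hm => ?_
  rw [coeff_trunc, if_pos (Finset.mem_range.mp hm)]

theorem evalSeries_add (p q : k⟦X⟧) {φ : WithConv (V →ₗ[k] W⟦X⟧)} (h : TopNilp φ) :
    evalSeries (p + q) φ h = evalSeries p φ h + evalSeries q φ h := by
  ext v n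
  obtain ⟨K, hK⟩ := h v (n + 1)
  have hK' : ∀ m ≥ K, coeff n ((φ ^ m) v) = 0 := fun m hm => hK m hm n (by omega)
  rw [coeff_evalSeries_eq_sum _ h v n K hK', ofConv_add, LinearMap.add_apply, map_add,
    coeff_evalSeries_eq_sum _ h v n K hK', coeff_evalSeries_eq_sum _ h v n K hK',
    ← Finset.sum_add_distrib]
  exact Finset.sum_congr rfl fun m _ => by rw [map_add, add_smul]

theorem evalSeries_one {φ : WithConv (V →ₗ[k] W⟦X⟧)} (h : TopNilp φ) : evalSeries 1 φ h = 1 := by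
  ext v n
  rw [coeff_evalSeries, finsum_eq_single _ 0]
  · simp
  · intro m hm
    rw [coeff_one, if_neg hm, zero_smul]

theorem evalSeries_X {φ : WithConv (V →ₗ[k] W⟦X⟧)} (h : TopNilp φ) : evalSeries X φ h = φ := by
  ext v n
  rw [coeff_evalSeries, finsum_eq_single _ 1]
  · simp
  · intro m hm
    rw [coeff_X, if_neg hm, zero_smul]

theorem coeff_conv_mul (φ ψ : WithConv (V →ₗ[k] W⟦X⟧)) (v : V) (n : ℕ) {ι : Type*}
    (r : Coalgebra.Repr k v ι) :
    coeff n ((φ * ψ) v) = ∑ i ∈ r.index, ∑ q ∈ Finset.HasAntidiagonal.antidiagonal n,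
      coeff q.1 (φ (r.left i)) * coeff q.2 (ψ (r.right i)) := by
  rw [r.convMul_apply, map_sum]
  exact Finset.sum_congr rfl fun i _ => coeff_mul _ _ _

theorem evalSeries_mul (p q : k⟦X⟧) {φ : WithConv (V →ₗ[k] W⟦X⟧)} (h : TopNilp φ) :
    evalSeries (p * q) φ h = evalSeries p φ h * evalSeries q φ h := by
  ext v n
  have hφ := h
  choose κ hκ using hφ
  let r := Coalgebra.Repr.arbitrary k v
  let K := κ v (n + 1) + ∑ i ∈ r.index, (κ (r.left i) (n + 1) + κ (r.right i) (n + 1))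
  have hi : ∀ i ∈ r.index, κ (r.left i) (n + 1) + κ (r.right i) (n + 1) ≤ K := fun i hi =>
    (Finset.single_le_sum (f := fun i => κ (r.left i) (n + 1) + κ (r.right i) (n + 1))
      (fun _ _ => Nat.zero_le _) hi).trans (Nat.le_add_left _ _)
  have h0 : ∀ m ≥ K, coeff n ((φ ^ m) v) = 0 := fun m hm =>
    hκ v (n + 1) m ((Nat.le_add_right _ _).trans hm) n (by omega)
  have hl : ∀ i ∈ r.index, ∀ c ≤ n, ∀ m ≥ K, coeff c ((φ ^ m) (r.left i)) = 0 :=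
    fun i hii c hc m hm => hκ _ (n + 1) m (by have := hi i hii; omega) c (by omega)
  have hr : ∀ i ∈ r.index, ∀ c ≤ n, ∀ m ≥ K, coeff c ((φ ^ m) (r.right i)) = 0 :=
    fun i hii c hc m hm => hκ _ (n + 1) m (by have := hi i hii; omega) c (by omega)
  have hP : coeff n ((evalSeries p φ h * evalSeries q φ h) v) =
      coeff n ((Polynomial.aeval φ (trunc K p) * Polynomial.aeval φ (trunc K q)) v) := by
    rw [coeff_conv_mul _ _ v n r, coeff_conv_mul _ _ v n r]
    refine Finset.sum_congr rfl fun i hii => Finset.sum_congr rfl fun c hc => ?_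
    rw [Finset.HasAntidiagonal.mem_antidiagonal] at hc
    rw [coeff_evalSeries_eq_aeval p h _ _ K (hl i hii _ (by omega)),
      coeff_evalSeries_eq_aeval q h _ _ K (hr i hii _ (by omega))]
  rw [hP, ← map_mul, coeff_aeval_apply _ v n K h0, coeff_evalSeries_eq_sum _ h v n K h0]
  refine Finset.sum_congr rfl fun m hm => ?_
  rw [Finset.mem_range] at hm
  rw [coeff_mul_eq_coeff_trunc_mul_trunc p q hm, ← Polynomial.coe_mul, Polynomial.coeff_coe]

theorem evalSeries_pow (p : k⟦X⟧) {φ : WithConv (V →ₗ[k] W⟦X⟧)} (h : TopNilp φ) (m : ℕ) :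
    evalSeries (p ^ m) φ h = evalSeries p φ h ^ m := by
  induction m with
  | zero => rw [pow_zero, pow_zero, evalSeries_one]
  | succ m ih => rw [pow_succ, pow_succ, evalSeries_mul, ih]

theorem evalSeries_sub_one (p : k⟦X⟧) {φ : WithConv (V →ₗ[k] W⟦X⟧)} (h : TopNilp φ) :
    evalSeries (p - 1) φ h = evalSeries p φ h - 1 := by
  rw [eq_sub_iff_add_eq, ← evalSeries_one h, ← evalSeries_add, sub_add_cancel]

theorem coeff_pow_eq_zero {q : k⟦X⟧} (hq : constantCoeff q = 0) {s m : ℕ} (hsm : s < m) :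
    coeff s (q ^ m) = 0 :=
  (X_pow_dvd_iff.mp (pow_dvd_pow_of_dvd (X_dvd_iff.mpr hq) m)) s hsm

theorem coeff_evalSeries_pow {q : k⟦X⟧} (hq : constantCoeff q = 0)
    {φ : WithConv (V →ₗ[k] W⟦X⟧)} (h : TopNilp φ) (v : V) (n K : ℕ)
    (hK : ∀ m ≥ K, coeff n ((φ ^ m) v) = 0) (m : ℕ) (hm : m ≥ K) :
    coeff n ((evalSeries q φ h ^ m) v) = 0 := by
  rw [← evalSeries_pow, coeff_evalSeries_eq_sum _ h v n K hK]
  refine Finset.sum_eq_zero fun s hs => ?_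
  rw [coeff_pow_eq_zero hq ((Finset.mem_range.mp hs).trans_le hm), zero_smul]

theorem TopNilp.evalSeries {q : k⟦X⟧} (hq : constantCoeff q = 0)
    {φ : WithConv (V →ₗ[k] W⟦X⟧)} (h : TopNilp φ) : TopNilp (evalSeries q φ h) := by
  intro v N
  obtain ⟨K, hK⟩ := h v N
  exact ⟨K, fun m hm n hn =>
    coeff_evalSeries_pow hq h v n K (fun m hm => hK m hm n hn) m hm⟩

theorem evalSeries_evalSeries (p : k⟦X⟧) {q : k⟦X⟧} (hq : constantCoeff q = 0)
    {φ : WithConv (V →ₗ[k] W⟦X⟧)} (h : TopNilp φ) (h' : TopNilp (evalSeries q φ h)) :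
    evalSeries p (evalSeries q φ h) h' = evalSeries (p.subst q) φ h := by
  ext v n
  obtain ⟨K, hK⟩ := h v (n + 1)
  have hK' : ∀ m ≥ K, coeff n ((φ ^ m) v) = 0 := fun m hm => hK m hm n (by omega)
  rw [coeff_evalSeries_eq_sum p h' v n K (coeff_evalSeries_pow hq h v n K hK'),
    coeff_evalSeries_eq_sum _ h v n K hK']
  have h1 : ∀ m, coeff n ((evalSeries q φ h ^ m) v) =
      ∑ s ∈ Finset.range K, coeff s (q ^ m) • coeff n ((φ ^ s) v) := fun m => by
    rw [← evalSeries_pow, coeff_evalSeries_eq_sum _ h v n K hK']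
  simp only [h1, Finset.smul_sum]
  rw [Finset.sum_comm]
  refine Finset.sum_congr rfl fun s hs => ?_
  rw [coeff_subst' (HasSubst.of_constantCoeff_zero' hq),
    finsum_eq_sum_of_support_subset (s := Finset.range K), Finset.sum_smul]
  · exact Finset.sum_congr rfl fun m _ => by rw [smul_assoc]
  · intro m hm
    by_contra hlt
    rw [Finset.mem_coe, Finset.mem_range, not_lt] at hlt
    exact hm (by simp [coeff_pow_eq_zero hq ((Finset.mem_range.mp hs).trans_le hlt)])

theorem log_subst_exp_sub_one [CharZero k] : (PowerSeries.log k).subst (PowerSeries.exp k - 1) = X := by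
  have hs : HasSubst (PowerSeries.exp k - 1) := HasSubst.exp_sub_one
  refine derivative.ext ?_ ?_
  · rw [derivative_subst hs, deriv_log, map_sub, derivative_exp, Derivation.map_one_eq_zero,
      sub_zero, derivative_X]
    have h1 : (PowerSeries.mk fun n => algebraMap ℚ k ((-1 : ℚ) ^ n)) * (1 + X : k⟦X⟧) = 1 := by
      ext n
      cases n with
      | zero => simp
      | succ n => simp [mul_add, coeff_succ_mul_X, pow_succ]
    have h2 := congrArg (substAlgHom (R := k) hs) h1
    rw [map_mul, map_add, map_one, substAlgHom_X] at h2
    rwa [coe_substAlgHom, add_sub_cancel] at h2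
  · rw [constantCoeff_X]
    exact constantCoeff_subst_eq_zero (by simp [← constantCoeff_eq]) _ constantCoeff_log

theorem exp_sub_one_subst_log [CharZero k] : (PowerSeries.exp k - 1).subst (PowerSeries.log k) = X := by
  have hs : HasSubst (PowerSeries.exp k - 1) := HasSubst.exp_sub_one
  have hl : HasSubst (PowerSeries.log k) := HasSubst.log
  have hu : IsUnit ((PowerSeries.log k).coeff 1) := by simp
  have hc : constantCoeff (PowerSeries.log k) = 0 := constantCoeff_log
  have hr := subst_substInvOfIsUnit_left _ hc hu
  have he : (PowerSeries.log k).substInvOfIsUnit hu = PowerSeries.exp k - 1 := by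
    have h1 := subst_comp_subst_apply (R := k) hl hs ((PowerSeries.log k).substInvOfIsUnit hu)
    rw [hr, log_subst_exp_sub_one, subst_X hs, X_subst] at h1
    exact h1.symm
  rw [← he, hr]

/-- The convolution exponential `exp φ = 1 + φ + φ²/2! + ⋯`. -/
def convExp [CharZero k] (φ : WithConv (V →ₗ[k] W⟦X⟧)) (h : TopNilp φ) :
    WithConv (V →ₗ[k] W⟦X⟧) :=
  evalSeries (PowerSeries.exp k) φ h

/-- The convolution logarithm `log ψ = (ψ - 1) - (ψ - 1)²/2 + (ψ - 1)³/3 - ⋯`. -/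
def convLog [CharZero k] (ψ : WithConv (V →ₗ[k] W⟦X⟧)) (h : TopNilp (ψ - 1)) :
    WithConv (V →ₗ[k] W⟦X⟧) :=
  evalSeries (PowerSeries.log k) (ψ - 1) h

theorem evalSeries_congr (p : k⟦X⟧) {φ ψ : WithConv (V →ₗ[k] W⟦X⟧)} (e : φ = ψ) (h : TopNilp φ)
    (h' : TopNilp ψ) : evalSeries p φ h = evalSeries p ψ h' := by
  subst e
  rfl

theorem convExp_sub_one [CharZero k] (φ : WithConv (V →ₗ[k] W⟦X⟧)) (h : TopNilp φ) :
    convExp φ h - 1 = evalSeries (PowerSeries.exp k - 1) φ h :=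
  (evalSeries_sub_one _ h).symm

theorem convLog_convExp [CharZero k] (φ : WithConv (V →ₗ[k] W⟦X⟧)) (h : TopNilp φ)
    (h' : TopNilp (convExp φ h - 1)) : convLog (convExp φ h) h' = φ := by
  have hc : constantCoeff (PowerSeries.exp k - 1) = 0 := by simp
  rw [convLog, evalSeries_congr _ (convExp_sub_one φ h) h' (h.evalSeries hc),
    evalSeries_evalSeries _ hc, log_subst_exp_sub_one, evalSeries_X]

theorem convExp_convLog [CharZero k] (ψ : WithConv (V →ₗ[k] W⟦X⟧)) (h : TopNilp (ψ - 1))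
    (h' : TopNilp (convLog ψ h)) : convExp (convLog ψ h) h' = ψ := by
  have hc : constantCoeff (PowerSeries.log k) = 0 := constantCoeff_log
  have h1 := convExp_sub_one _ h'
  have h2 : evalSeries (PowerSeries.exp k - 1) (convLog ψ h) h' = ψ - 1 :=
    (evalSeries_evalSeries (PowerSeries.exp k - 1) hc h h').trans (by
      rw [exp_sub_one_subst_log, evalSeries_X])
  exact sub_left_injective (h1.trans h2)

end Convolution

section Conilpotency

variable {k : Type u} [Field k] {V : Type v} [Ring V] [Algebra k V] [Coalgebra k V]
  {W : Type w} [Ring W] [Algebra k W]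

variable (k V) in
/-- The reduced diagonal: the linear map with `v ↦ δ(v) - v ⊗ 1 - 1 ⊗ v` on the augmentation
ideal and `1 ↦ 0` (for a coalgebra with `δ(1) = 1 ⊗ 1` and `ε(1) = 1`). -/
def redComul : V →ₗ[k] V ⊗[k] V :=
  Coalgebra.comul - (TensorProduct.mk k V V).flip 1 - TensorProduct.mk k V V 1 +
    (Coalgebra.counit (R := k) (A := V)).smulRight (1 ⊗ₜ[k] 1)

variable (k V) in
/-- The iterated reduced diagonal `V → V^{⊗ (n+1)}`; the tensor power `V^{⊗ (n+1)}` is realised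
inside the tensor algebra of `V`. -/
def redComulIter : ℕ → (V →ₗ[k] TensorAlgebra k V)
  | 0 => TensorAlgebra.ι k
  | n + 1 => LinearMap.mul' k (TensorAlgebra k V) ∘ₗ
      TensorProduct.map (redComulIter n) (TensorAlgebra.ι k) ∘ₗ redComul k V

theorem comul_eq_redComul (v : V) : (Coalgebra.comul v : V ⊗[k] V) =
    redComul k V v + v ⊗ₜ 1 + 1 ⊗ₜ v - Coalgebra.counit (R := k) v • (1 ⊗ₜ[k] 1) := by
  simp only [redComul, LinearMap.add_apply, LinearMap.sub_apply, LinearMap.flip_apply,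
    TensorProduct.mk_apply, LinearMap.smulRight_apply]
  abel

theorem conv_pow_one (h1 : (Coalgebra.comul (1 : V) : V ⊗[k] V) = 1 ⊗ₜ 1)
    (h2 : Coalgebra.counit (R := k) (1 : V) = 1)
    (φ : WithConv (V →ₗ[k] W⟦X⟧)) (m : ℕ) : (φ ^ m) 1 = φ 1 ^ m := by
  induction m with
  | zero => simp [h2]
  | succ m ih => rw [pow_succ, pow_succ, LinearMap.convMul_apply, h1, TensorProduct.map_tmul,
      LinearMap.mul'_apply, ih]

theorem conv_pow_of_map_one_eq_zero (h1 : (Coalgebra.comul (1 : V) : V ⊗[k] V) = 1 ⊗ₜ 1)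
    (h2 : Coalgebra.counit (R := k) (1 : V) = 1)
    (φ : WithConv (V →ₗ[k] W⟦X⟧)) (h : φ 1 = 0) (m : ℕ) (v : V) :
    (φ ^ (m + 1)) v = TensorAlgebra.lift k φ.ofConv (redComulIter k V m v) := by
  induction m generalizing v with
  | zero => simp [redComulIter]
  | succ m ih =>
    have h3 : (φ ^ (m + 1)) 1 = 0 := by rw [conv_pow_one h1 h2, h, zero_pow (by omega)]
    rw [pow_succ, LinearMap.convMul_apply, comul_eq_redComul, map_sub, map_add, map_add, map_smul,
      TensorProduct.map_tmul, TensorProduct.map_tmul, TensorProduct.map_tmul, h, h3,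
      TensorProduct.tmul_zero, TensorProduct.zero_tmul, TensorProduct.tmul_zero, smul_zero,
      add_zero, add_zero, sub_zero]
    simp only [redComulIter, LinearMap.comp_apply]
    induction redComul k V v with
    | zero => simp
    | add x y hx hy => simp only [map_add, hx, hy]
    | tmul x y => simp [ih]

theorem conv_scalar_mul (w : W⟦X⟧) (ψ : WithConv (V →ₗ[k] W⟦X⟧)) (v : V) :
    ((toConv ((Coalgebra.counit (R := k) (A := V)).smulRight w) : WithConv (V →ₗ[k] W⟦X⟧)) * ψ) v =
      w * ψ v := by
  let r := Coalgebra.Repr.arbitrary k v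
  rw [r.convMul_apply]
  conv_rhs => rw [← Coalgebra.sum_counit_smul r, map_sum, Finset.mul_sum]
  exact Finset.sum_congr rfl fun i _ => by simp

theorem conv_mul_scalar (w : W⟦X⟧) (ψ : WithConv (V →ₗ[k] W⟦X⟧)) (v : V) :
    (ψ * (toConv ((Coalgebra.counit (R := k) (A := V)).smulRight w) : WithConv (V →ₗ[k] W⟦X⟧))) v =
      ψ v * w := by
  let r := Coalgebra.Repr.arbitrary k v
  rw [r.convMul_apply]
  have h : ∑ i ∈ r.index, Coalgebra.counit (R := k) (r.right i) • r.left i = v := by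
    have h' := congrArg (TensorProduct.rid k V) (Coalgebra.sum_tmul_counit_eq r)
    rwa [map_sum, TensorProduct.rid_tmul, one_smul] at h'
  conv_rhs => rw [← h, map_sum, Finset.sum_mul]
  exact Finset.sum_congr rfl fun i _ => by simp

theorem topNilp_of_conilpotent (h1 : (Coalgebra.comul (1 : V) : V ⊗[k] V) = 1 ⊗ₜ 1)
    (h2 : Coalgebra.counit (R := k) (1 : V) = 1)
    (hV : ∀ v : V, ∃ K, ∀ m ≥ K, redComulIter k V m v = 0)
    (φ : WithConv (V →ₗ[k] W⟦X⟧)) (h0 : coeff 0 (φ 1) = 0) (hc : ∀ v, φ 1 * φ v = φ v * φ 1) :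
    TopNilp φ := by
  intro v N
  obtain ⟨K, hK⟩ := hV v
  let c : WithConv (V →ₗ[k] W⟦X⟧) := toConv ((Coalgebra.counit (R := k) (A := V)).smulRight (φ 1))
  have hcapp : ∀ x, c x = Coalgebra.counit (R := k) x • φ 1 := fun x => rfl
  let ψ := φ - c
  have hψ1 : ψ 1 = 0 := by
    change φ 1 - c 1 = 0
    rw [hcapp, h2, one_smul, sub_self]
  have hcomm : Commute c ψ := by
    ext1
    refine LinearMap.ext fun x => ?_
    rw [conv_scalar_mul, conv_mul_scalar]
    change φ 1 * (φ x - c x) = (φ x - c x) * φ 1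
    rw [hcapp, mul_sub, sub_mul, hc, mul_smul_comm, smul_mul_assoc]
  have hcp : ∀ (i : ℕ) (χ : WithConv (V →ₗ[k] W⟦X⟧)), (c ^ i * χ) v = φ 1 ^ i * χ v := by
    intro i
    induction i with
    | zero => intro χ; simp
    | succ i ih => intro χ; rw [pow_succ, mul_assoc, ih, conv_scalar_mul, pow_succ, mul_assoc]
  have hX : (X : W⟦X⟧) ∣ φ 1 := X_dvd_iff.mpr (by rwa [← coeff_zero_eq_constantCoeff_apply])
  refine ⟨K + 1 + N, fun m hm n hn => ?_⟩
  have hφ : φ = c + ψ := (add_sub_cancel c φ).symm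
  rw [hφ, hcomm.add_pow, ofConv_sum, LinearMap.sum_apply, map_sum]
  refine Finset.sum_eq_zero fun i hi => ?_
  have hi' : i ≤ m := by simpa [Nat.lt_succ_iff] using hi
  rw [← nsmul_eq_mul', ofConv_smul, LinearMap.smul_apply, map_nsmul, hcp]
  suffices coeff n (φ 1 ^ i * (ψ ^ (m - i)) v) = 0 by rw [this, smul_zero]
  by_cases h : K + 1 ≤ m - i
  · obtain ⟨j, hj⟩ : ∃ j, m - i = j + 1 := ⟨m - i - 1, by omega⟩
    rw [hj, conv_pow_of_map_one_eq_zero h1 h2 ψ hψ1, hK j (by omega), map_zero, mul_zero, map_zero]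
  · obtain ⟨y, hy⟩ := hX
    have hcX : Commute (X : W⟦X⟧) y := (commute_X y).symm
    rw [hy, hcX.mul_pow, mul_assoc, coeff_X_pow_mul', if_neg (by omega)]

end Conilpotency

end MVAlgebra

open MVAlgebra

/-- The degree `d` part of the tensor product of two graded vector spaces. -/
def tensorDeg {k : Type u} [Field k] {V : Type v} [AddCommGroup V] [Module k V]
    {W : Type w} [AddCommGroup W] [Module k W]
    (𝒱 : ℤ → Submodule k V) (𝒲 : ℤ → Submodule k W) (d : ℤ) : Submodule k (V ⊗[k] W) :=
  Submodule.span k {t | ∃ i j : ℤ, ∃ a ∈ 𝒱 i, ∃ b ∈ 𝒲 j, i + j = d ∧ t = a ⊗ₜ[k] b}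

/-- MV-algebras over `k⟦ℏ⟧`, with `V ⊗̂ k⟦ℏ⟧ = V⟦X⟧`.  Continuity of `Δ` in the `ℏ`-adic topology is
automatic for a `k⟦ℏ⟧`-linear map. -/
structure MVAlg (k : Type u) [Field k] where
  /-- The underlying vector space. -/
  V : Type v
  [ring : Ring V]
  [algebra : Algebra k V]
  [coalgebra : Coalgebra k V]
  /-- The grading. -/
  deg : ℤ → Submodule k V
  [graded : GradedAlgebra deg]
  /-- Graded commutativity. -/
  mul_comm : ∀ i j : ℤ, ∀ a ∈ deg i, ∀ b ∈ deg j, a * b = (-1 : ℤˣ) ^ (i * j) • (b * a)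
  /-- The comultiplication has degree zero. -/
  comul_mem : ∀ d : ℤ, ∀ v ∈ deg d, (Coalgebra.comul v : V ⊗[k] V) ∈ tensorDeg deg deg d
  /-- The counit has degree zero. -/
  counit_deg : ∀ d : ℤ, d ≠ 0 → ∀ v ∈ deg d, Coalgebra.counit (R := k) v = 0
  /-- Graded cocommutativity: the comultiplication is invariant under the Koszul-signed flip. -/
  cocomm : ∀ v : V, GradedTensorProduct.comm deg deg
      (GradedTensorProduct.of k deg deg (Coalgebra.comul v)) =
        GradedTensorProduct.of k deg deg (Coalgebra.comul v)
  /-- The unit is a coaugmentation. -/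
  comul_one : (Coalgebra.comul (1 : V) : V ⊗[k] V) = 1 ⊗ₜ 1
  /-- The counit is an augmentation. -/
  counit_one : Coalgebra.counit (R := k) (1 : V) = 1
  counit_mul : ∀ a b : V, Coalgebra.counit (R := k) (a * b) =
    Coalgebra.counit (R := k) a * Coalgebra.counit (R := k) b
  conilpotent : ∀ v : V, ∃ K, ∀ m ≥ K, redComulIter k V m v = 0
  /-- The structure operator. -/
  Δ : V⟦X⟧ →ₗ[k⟦X⟧] V⟦X⟧
  Δ_deg : ∀ d : ℤ, ∀ v ∈ deg d, ∀ n : ℕ, coeff n (Δ (C v)) ∈ deg (d + 1)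
  Δ_sq : Δ ∘ₗ Δ = 0
  Δ_one : Δ 1 = 0

namespace MVAlg

attribute [instance] MVAlg.ring MVAlg.algebra MVAlg.coalgebra MVAlg.graded

variable {k : Type u} [Field k]

/-- `Lin_R(A, B)` for `R = k⟦ℏ⟧`: the (continuous) `k⟦ℏ⟧`-linear maps `A⟦ℏ⟧ → B⟦ℏ⟧` of degree
zero. -/
def IsDegZero {A B : MVAlg.{u, v} k} (F : A.V⟦X⟧ →ₗ[k⟦X⟧] B.V⟦X⟧) : Prop :=
  ∀ d : ℤ, ∀ v ∈ A.deg d, ∀ n : ℕ, coeff n (F (C v)) ∈ B.deg d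

/-- `Lin⁰_R(A, B)`: the degree zero maps `f` with `f(1) ∈ V ⊗̂ 𝔪`, where `𝔪 = (ℏ)`. -/
@[ext]
structure Lin0 (A B : MVAlg.{u, v} k) where
  toLin : A.V⟦X⟧ →ₗ[k⟦X⟧] B.V⟦X⟧
  degZero : IsDegZero toLin
  map_unit : coeff 0 (toLin 1) = 0

/-- `𝖾 + Lin⁰_R(A, B)`: the degree zero maps `φ` with `φ(1) ≡ 1` modulo `V ⊗̂ 𝔪`. -/
@[ext]
structure Lin1 (A B : MVAlg.{u, v} k) where
  toLin : A.V⟦X⟧ →ₗ[k⟦X⟧] B.V⟦X⟧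
  degZero : IsDegZero toLin
  map_unit : coeff 0 (toLin 1) = 1

section

variable {A B D : MVAlg.{u, v} k}

/-- The element of the convolution algebra of maps `A → B⟦ℏ⟧` given by a `k⟦ℏ⟧`-linear map. -/
def toConvAlg (F : A.V⟦X⟧ →ₗ[k⟦X⟧] B.V⟦X⟧) : WithConv (A.V →ₗ[k] B.V⟦X⟧) := toConv (restr F)

/-- The `k⟦ℏ⟧`-linear map given by an element of the convolution algebra. -/
def ofConvAlg (φ : WithConv (A.V →ₗ[k] B.V⟦X⟧)) : A.V⟦X⟧ →ₗ[k⟦X⟧] B.V⟦X⟧ := extend φ.ofConv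

theorem ofConvAlg_toConvAlg (F : A.V⟦X⟧ →ₗ[k⟦X⟧] B.V⟦X⟧) : ofConvAlg (toConvAlg F) = F :=
  extend_restr F

theorem toConvAlg_ofConvAlg (φ : WithConv (A.V →ₗ[k] B.V⟦X⟧)) : toConvAlg (ofConvAlg φ) = φ := by
  rw [toConvAlg, ofConvAlg, restr_extend]

theorem toConvAlg_apply (F : A.V⟦X⟧ →ₗ[k⟦X⟧] B.V⟦X⟧) (v : A.V) : toConvAlg F v = F (C v) := rfl

theorem ofConvAlg_C (φ : WithConv (A.V →ₗ[k] B.V⟦X⟧)) (v : A.V) : ofConvAlg φ (C v) = φ v := by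
  rw [← toConvAlg_apply, toConvAlg_ofConvAlg]

theorem ofConvAlg_one (φ : WithConv (A.V →ₗ[k] B.V⟦X⟧)) : ofConvAlg φ 1 = φ 1 := by
  rw [← ofConvAlg_C, map_one (C : A.V →+* A.V⟦X⟧)]

theorem toConvAlg_one_apply (F : A.V⟦X⟧ →ₗ[k⟦X⟧] B.V⟦X⟧) : toConvAlg F 1 = F 1 := by
  rw [toConvAlg_apply, map_one]

/-- Degree zero elements of the convolution algebra. -/
def ConvDegZero (φ : WithConv (A.V →ₗ[k] B.V⟦X⟧)) : Prop :=
  ∀ d : ℤ, ∀ v ∈ A.deg d, ∀ n : ℕ, coeff n (φ v) ∈ B.deg d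

theorem convDegZero_one : ConvDegZero (1 : WithConv (A.V →ₗ[k] B.V⟦X⟧)) := by
  intro d v hv n
  rw [LinearMap.convOne_apply]
  by_cases hd : d = 0
  · subst hd
    rw [PowerSeries.algebraMap_apply, coeff_C]
    split_ifs
    · exact SetLike.algebraMap_mem_graded B.deg _
    · exact zero_mem _
  · rw [A.counit_deg d hd v hv, map_zero, map_zero]
    exact zero_mem _

theorem ConvDegZero.mul {φ ψ : WithConv (A.V →ₗ[k] B.V⟦X⟧)} (hφ : ConvDegZero φ)
    (hψ : ConvDegZero ψ) : ConvDegZero (φ * ψ) := by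
  intro d v hv n
  rw [LinearMap.convMul_apply]
  have h := A.comul_mem d v hv
  rw [tensorDeg] at h
  generalize (Coalgebra.comul v : A.V ⊗[k] A.V) = t at h
  induction h using Submodule.span_induction with
  | zero => simp
  | add x y _ _ hx hy =>
    rw [map_add, map_add, map_add]
    exact add_mem hx hy
  | smul c x _ hx =>
    rw [map_smul, map_smul, PowerSeries.coeff_smul]
    exact Submodule.smul_mem _ _ hx
  | mem x hx =>
    obtain ⟨i, j, a, ha, b, hb, rfl, rfl⟩ := hx
    rw [TensorProduct.map_tmul, LinearMap.mul'_apply, coeff_mul]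
    exact sum_mem fun q _ => SetLike.mul_mem_graded (hφ i a ha _) (hψ j b hb _)

theorem ConvDegZero.pow {φ : WithConv (A.V →ₗ[k] B.V⟦X⟧)} (hφ : ConvDegZero φ) (m : ℕ) :
    ConvDegZero (φ ^ m) := by
  induction m with
  | zero => rw [pow_zero]; exact convDegZero_one
  | succ m ih => rw [pow_succ]; exact ih.mul hφ

theorem ConvDegZero.evalSeries {φ : WithConv (A.V →ₗ[k] B.V⟦X⟧)} (hφ : ConvDegZero φ)
    (p : k⟦X⟧) (h : TopNilp φ) : ConvDegZero (evalSeries p φ h) := by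
  intro d v hv n
  obtain ⟨K, hK⟩ := h v (n + 1)
  rw [coeff_evalSeries_eq_sum p h v n K fun m hm => hK m hm n (by omega)]
  exact sum_mem fun m _ => Submodule.smul_mem _ _ (hφ.pow m d v hv n)

theorem evalSeries_map_one {φ : WithConv (A.V →ₗ[k] B.V⟦X⟧)} (h0 : coeff 0 (φ 1) = 0)
    (p : k⟦X⟧) (h : TopNilp φ) :
    coeff 0 (evalSeries p φ h 1) = algebraMap k B.V (constantCoeff p) := by
  rw [coeff_evalSeries, finsum_eq_single _ 0]
  · rw [pow_zero, LinearMap.convOne_apply, A.counit_one, map_one, coeff_zero_one,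
      Algebra.algebraMap_eq_smul_one, coeff_zero_eq_constantCoeff_apply]
  · intro m hm
    rw [conv_pow_one A.comul_one A.counit_one, coeff_zero_eq_constantCoeff_apply, map_pow,
      ← coeff_zero_eq_constantCoeff_apply, h0, zero_pow hm, smul_zero]

theorem commute_of_degZero {b : B.V} (hb : b ∈ B.deg 0) (c : B.V) : b * c = c * b := by
  have hc : c ∈ ⨆ d, B.deg d := by
    rw [(DirectSum.Decomposition.isInternal B.deg).submodule_iSup_eq_top]
    trivial
  induction hc using Submodule.iSup_induction' with
  | mem d x hx => rw [B.mul_comm 0 d b hb x hx, zero_mul]; simp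
  | zero => simp
  | add x y _ _ hx hy => rw [mul_add, add_mul, hx, hy]

theorem series_commute_of_degZero {b : B.V⟦X⟧} (hb : ∀ n, coeff n b ∈ B.deg 0) (c : B.V⟦X⟧) :
    b * c = c * b := by
  ext n
  rw [coeff_mul, coeff_mul, ← Finset.Nat.sum_antidiagonal_swap]
  exact Finset.sum_congr rfl fun q _ => commute_of_degZero (hb _) _

theorem one_mem_deg : (1 : A.V) ∈ A.deg 0 := SetLike.one_mem_graded A.deg

theorem topNilp {φ : WithConv (A.V →ₗ[k] B.V⟦X⟧)} (hφ : ConvDegZero φ) (h0 : coeff 0 (φ 1) = 0) :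
    TopNilp φ :=
  topNilp_of_conilpotent A.comul_one A.counit_one A.conilpotent φ h0 fun _ =>
    series_commute_of_degZero (fun n => hφ 0 1 one_mem_deg n) _

theorem Lin0.convDegZero (f : Lin0 A B) : ConvDegZero (toConvAlg f.toLin) := f.degZero

theorem Lin1.convDegZero (φ : Lin1 A B) : ConvDegZero (toConvAlg φ.toLin - 1) := by
  intro d v hv n
  rw [ofConv_sub, LinearMap.sub_apply, map_sub]
  exact sub_mem (φ.degZero d v hv n) (convDegZero_one d v hv n)

theorem Lin1.coeff_sub_one (φ : Lin1 A B) : coeff 0 ((toConvAlg φ.toLin - 1) 1) = 0 := by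
  rw [ofConv_sub, LinearMap.sub_apply, toConvAlg_one_apply, map_sub, φ.map_unit,
    LinearMap.convOne_apply, A.counit_one, map_one (algebraMap k B.V⟦X⟧), coeff_zero_one, sub_self]

theorem Lin0.topNilp (f : Lin0 A B) : TopNilp (toConvAlg f.toLin) :=
  MVAlg.topNilp f.degZero (by rw [toConvAlg_one_apply, f.map_unit])

theorem Lin1.topNilp (φ : Lin1 A B) : TopNilp (toConvAlg φ.toLin - 1) :=
  MVAlg.topNilp φ.convDegZero φ.coeff_sub_one

variable [CharZero k]

/-- The exponential `exp f = 𝖾 + f + f²/2! + ⋯` with respect to the convolution product. -/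
def exp (f : Lin0 A B) : Lin1 A B where
  toLin := ofConvAlg (convExp (toConvAlg f.toLin) f.topNilp)
  degZero d v hv n := by
    rw [ofConvAlg_C]
    exact ConvDegZero.evalSeries f.convDegZero _ _ d v hv n
  map_unit := by
    rw [ofConvAlg_one]
    refine (evalSeries_map_one (by rw [toConvAlg_one_apply, f.map_unit]) _ _).trans ?_
    simp

/-- The logarithm `log φ = (φ - 𝖾) - (φ - 𝖾)²/2 + ⋯` with respect to the convolution product. -/
def log (φ : Lin1 A B) : Lin0 A B where
  toLin := ofConvAlg (convLog (toConvAlg φ.toLin) φ.topNilp)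
  degZero d v hv n := by
    rw [ofConvAlg_C]
    exact ConvDegZero.evalSeries φ.convDegZero _ _ d v hv n
  map_unit := by
    rw [ofConvAlg_one]
    refine (evalSeries_map_one φ.coeff_sub_one _ _).trans ?_
    simp

theorem log_exp (f : Lin0 A B) : log (exp f) = f := by
  ext1
  have h : toConvAlg (exp f).toLin = convExp (toConvAlg f.toLin) f.topNilp :=
    toConvAlg_ofConvAlg _
  have h' : TopNilp (convExp (toConvAlg f.toLin) f.topNilp - 1) := h ▸ (exp f).topNilp
  refine Eq.trans ?_ (ofConvAlg_toConvAlg f.toLin)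
  refine congrArg ofConvAlg (Eq.trans ?_ (convLog_convExp _ f.topNilp h'))
  exact evalSeries_congr _ (by rw [h]) _ _

theorem exp_log (φ : Lin1 A B) : exp (log φ) = φ := by
  ext1
  have h : toConvAlg (log φ).toLin = convLog (toConvAlg φ.toLin) φ.topNilp :=
    toConvAlg_ofConvAlg _
  have h' : TopNilp (convLog (toConvAlg φ.toLin) φ.topNilp) := h ▸ (log φ).topNilp
  refine Eq.trans ?_ (ofConvAlg_toConvAlg φ.toLin)
  refine congrArg ofConvAlg (Eq.trans ?_ (convExp_convLog _ φ.topNilp h'))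
  exact evalSeries_congr _ h _ _

end

/-- The identity map of `A⟦ℏ⟧`. -/
def Lin1.id (A : MVAlg.{u, v} k) : Lin1 A A where
  toLin := LinearMap.id
  degZero d v hv n := by
    rw [LinearMap.id_apply, coeff_C]
    split_ifs
    · exact hv
    · exact zero_mem _
  map_unit := by simp

/-- The composition `ψ ∘ φ`. -/
def Lin1.comp {A B D : MVAlg.{u, v} k} (ψ : Lin1 B D) (φ : Lin1 A B) : Lin1 A D where
  toLin := ψ.toLin ∘ₗ φ.toLin
  degZero d v hv n := by
    rw [LinearMap.comp_apply, coeff_apply_eq ψ.toLin (n + 1) n _ (by omega)]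
    exact sum_mem fun q _ => ψ.degZero d _ (φ.degZero d v hv _) _
  map_unit := by
    rw [LinearMap.comp_apply, coeff_apply_eq ψ.toLin 1 0 _ (by omega)]
    rw [Finset.HasAntidiagonal.antidiagonal_zero, Finset.sum_singleton, φ.map_unit, map_one C,
      ψ.map_unit]

section

variable [CharZero k]

/-- MV-morphisms: the `f ∈ Lin⁰_R(A, B)` with `Δ ∘ exp f = exp f ∘ Δ`. -/
@[ext]
structure Hom (A B : MVAlg.{u, v} k) extends Lin0 A B where
  comm : B.Δ ∘ₗ (exp toLin0).toLin = (exp toLin0).toLin ∘ₗ A.Δ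

/-- The unit endomorphism `log(id)`. -/
def Hom.id (A : MVAlg.{u, v} k) : Hom A A where
  toLin0 := log (Lin1.id A)
  comm := by rw [exp_log]; rfl

/-- The composition `f ⋄ g = log(exp f ∘ exp g)`. -/
def Hom.diamond {A B D : MVAlg.{u, v} k} (f : Hom B D) (g : Hom A B) : Hom A D where
  toLin0 := log ((exp f.toLin0).comp (exp g.toLin0))
  comm := by
    rw [exp_log]
    change D.Δ ∘ₗ (exp f.toLin0).toLin ∘ₗ (exp g.toLin0).toLin =
      ((exp f.toLin0).toLin ∘ₗ (exp g.toLin0).toLin) ∘ₗ A.Δ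
    rw [← LinearMap.comp_assoc, f.comm, LinearMap.comp_assoc, g.comm, LinearMap.comp_assoc]

theorem Hom.ext_exp {A B : MVAlg.{u, v} k} {f g : Hom A B}
    (h : exp f.toLin0 = exp g.toLin0) : f = g := by
  have h1 : f.toLin0 = g.toLin0 := by rw [← log_exp f.toLin0, h, log_exp]
  cases f
  cases g
  congr

theorem Hom.exp_diamond {A B D : MVAlg.{u, v} k} (f : Hom B D) (g : Hom A B) :
    exp (f.diamond g).toLin0 = (exp f.toLin0).comp (exp g.toLin0) :=
  exp_log _

theorem Hom.exp_id (A : MVAlg.{u, v} k) : exp (Hom.id A).toLin0 = Lin1.id A :=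
  exp_log _

/-- The category of MV-algebras over `k⟦ℏ⟧`. -/
instance category : CategoryTheory.Category (MVAlg.{u, v} k) where
  Hom := Hom
  id := Hom.id
  comp g f := f.diamond g
  id_comp f := Hom.ext_exp (by rw [Hom.exp_diamond, Hom.exp_id]; rfl)
  comp_id f := Hom.ext_exp (by rw [Hom.exp_diamond, Hom.exp_id]; rfl)
  assoc f g h := Hom.ext_exp (by simp only [Hom.exp_diamond]; rfl)

end

end MVAlg

section GrSym

open scoped DirectSum

variable {k : Type u} [Field k] (U : ℤ → Type v) [∀ i, AddCommGroup (U i)] [∀ i, Module k (U i)]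

variable (k) in
/-- The relations `x y = (-1)^{|x||y|} y x` for homogeneous generators. -/
inductive GrSym.Rel : TensorAlgebra k (⨁ i, U i) → TensorAlgebra k (⨁ i, U i) → Prop
  | swap (i j : ℤ) (x : U i) (y : U j) : GrSym.Rel
      (TensorAlgebra.ι k (DirectSum.lof k ℤ U i x) * TensorAlgebra.ι k (DirectSum.lof k ℤ U j y))
      ((-1 : ℤˣ) ^ (i * j) • (TensorAlgebra.ι k (DirectSum.lof k ℤ U j y) *
        TensorAlgebra.ι k (DirectSum.lof k ℤ U i x)))

variable (k) in
/-- The graded symmetric algebra `S(U)` of the graded vector space `U = ⨁ᵢ Uᵢ`. -/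
def GrSym : Type (max u v) := RingQuot (GrSym.Rel k U)

namespace GrSym

instance : Ring (GrSym k U) := inferInstanceAs (Ring (RingQuot (GrSym.Rel k U)))

instance : Algebra k (GrSym k U) := inferInstanceAs (Algebra k (RingQuot (GrSym.Rel k U)))

/-- The inclusion of the generators of degree `i`. -/
def ι (i : ℤ) : U i →ₗ[k] GrSym k U :=
  (RingQuot.mkAlgHom k (GrSym.Rel k U)).toLinearMap ∘ₗ TensorAlgebra.ι k ∘ₗ DirectSum.lof k ℤ U i

theorem units_smul_eq {M : Type*} [AddCommGroup M] [Module k M] (s : ℤˣ) (x : M) :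
    s • x = ((s : ℤ) : k) • x := by
  rw [Units.smul_def, Int.cast_smul_eq_zsmul]

theorem map_units_smul' {M N : Type*} [AddCommGroup M] [Module k M] [AddCommGroup N] [Module k N]
    (f : M →ₗ[k] N) (s : ℤˣ) (x : M) : f (s • x) = s • f x := by
  rw [units_smul_eq (k := k), units_smul_eq (k := k), map_smul]

theorem ι_comm (i j : ℤ) (x : U i) (y : U j) :
    (ι U i x * ι U j y : GrSym k U) = (-1 : ℤˣ) ^ (i * j) • (ι U j y * ι U i x) := by
  have h := RingQuot.mkAlgHom_rel k (GrSym.Rel.swap (k := k) i j x y)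
  rw [map_mul, ← AlgHom.toLinearMap_apply (RingQuot.mkAlgHom k _) (_ • _), map_units_smul',
    AlgHom.toLinearMap_apply, map_mul] at h
  exact h

variable {U}

section lift

variable {A : Type w} [Ring A] [Algebra k A]

/-- The universal property of `S(U)`. -/
def lift (f : ∀ i, U i →ₗ[k] A)
    (hf : ∀ i j x y, f i x * f j y = (-1 : ℤˣ) ^ (i * j) • (f j y * f i x)) : GrSym k U →ₐ[k] A :=
  RingQuot.liftAlgHom k ⟨TensorAlgebra.lift k (DirectSum.toModule k ℤ A f), by
    rintro _ _ ⟨i, j, x, y⟩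
    rw [map_mul, ← AlgHom.toLinearMap_apply (TensorAlgebra.lift k _) (_ • _), map_units_smul',
      AlgHom.toLinearMap_apply, map_mul, TensorAlgebra.lift_ι_apply, TensorAlgebra.lift_ι_apply,
      DirectSum.toModule_lof, DirectSum.toModule_lof, hf]⟩

theorem lift_ι (f : ∀ i, U i →ₗ[k] A)
    (hf : ∀ i j x y, f i x * f j y = (-1 : ℤˣ) ^ (i * j) • (f j y * f i x)) (i : ℤ) (x : U i) :
    lift f hf (ι U i x) = f i x := by
  have h : lift f hf (ι U i x) = TensorAlgebra.lift k (DirectSum.toModule k ℤ A f)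
      (TensorAlgebra.ι k (DirectSum.lof k ℤ U i x)) :=
    RingQuot.liftAlgHom_mkAlgHom_apply k _ _ _
  rw [h, TensorAlgebra.lift_ι_apply, DirectSum.toModule_lof]

theorem algHom_ext' {f g : GrSym k U →ₐ[k] A} (h : ∀ i x, f (ι U i x) = g (ι U i x)) : f = g := by
  refine RingQuot.ringQuot_ext' k f g (TensorAlgebra.hom_ext (DirectSum.linearMap_ext k ?_))
  intro i
  exact LinearMap.ext fun x => h i x

end lift

/-- The product `u₁ ⋯ uₙ` of a list of homogeneous generators. -/
def word (l : List (Σ i, U i)) : GrSym k U := (l.map fun p => ι U p.1 p.2).prod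

/-- The sum of the degrees of a list of homogeneous generators. -/
def wordDeg (l : List (Σ i, U i)) : ℤ := (l.map Sigma.fst).sum

variable (k U) in
/-- The degree `d` part of `S(U)`. -/
def deg (d : ℤ) : Submodule k (GrSym k U) :=
  Submodule.span k {s | ∃ l : List (Σ i, U i), wordDeg l = d ∧ s = word l}

variable (k U) in
/-- The symmetric power `Sⁿ(U)`, spanned by the products of `n` generators. -/
def symPow (n : ℕ) : Submodule k (GrSym k U) :=
  Submodule.span k {s | ∃ l : List (Σ i, U i), l.length = n ∧ s = word l}

theorem word_nil : word ([] : List (Σ i, U i)) = (1 : GrSym k U) := rfl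

theorem word_cons (p : Σ i, U i) (l : List (Σ i, U i)) :
    (word (p :: l) : GrSym k U) = ι U p.1 p.2 * word l := by
  rw [word, List.map_cons, List.prod_cons, word]

theorem wordDeg_cons {U : ℤ → Type v} (p : Σ i, U i) (l : List (Σ i, U i)) :
    wordDeg (p :: l) = p.1 + wordDeg l := by
  rw [wordDeg, List.map_cons, List.sum_cons, wordDeg]

theorem word_append (l l' : List (Σ i, U i)) : (word (l ++ l') : GrSym k U) = word l * word l' := by
  rw [word, List.map_append, List.prod_append, word, word]

theorem word_mem_deg (l : List (Σ i, U i)) : (word l : GrSym k U) ∈ deg k U (wordDeg l) :=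
  Submodule.subset_span ⟨l, rfl, rfl⟩

theorem word_single (i : ℤ) (x : U i) : (word [⟨i, x⟩] : GrSym k U) = ι U i x := by
  rw [word_cons, word_nil, mul_one]

theorem ι_mem_deg (i : ℤ) (x : U i) : (ι U i x : GrSym k U) ∈ deg k U i := by
  have h := word_mem_deg (k := k) [(⟨i, x⟩ : Σ i, U i)]
  rwa [word_single, wordDeg_cons, wordDeg, List.map_nil, List.sum_nil, add_zero] at h

instance gradedMonoid : SetLike.GradedMonoid (deg k U) where
  one_mem := word_mem_deg []
  mul_mem := by
    intro i j a b ha hb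
    have h := Submodule.mul_mem_mul ha hb
    rw [deg, deg, Submodule.span_mul_span] at h
    refine Submodule.span_le.mpr ?_ h
    rintro _ ⟨_, ⟨l, rfl, rfl⟩, _, ⟨l', rfl, rfl⟩, rfl⟩
    refine Submodule.subset_span ⟨l ++ l', ?_, (word_append l l').symm⟩
    rw [wordDeg, wordDeg, wordDeg, List.map_append, List.sum_append]

/-- The inclusion of generators into the direct sum of the graded pieces. -/
def toDirectSumι (i : ℤ) : U i →ₗ[k] ⨁ d, deg k U d where
  toFun x := DirectSum.of (fun d => deg k U d) i ⟨ι U i x, ι_mem_deg i x⟩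
  map_add' x y := by
    rw [← map_add]
    congr 1
    exact Subtype.ext (map_add _ _ _)
  map_smul' c x := by
    rw [← DirectSum.lof_eq_of k, ← DirectSum.lof_eq_of k, RingHom.id_apply, ← map_smul]
    congr 1
    exact Subtype.ext (map_smul _ _ _)

/-- The map into the direct sum of the graded pieces. -/
def toDirectSum : GrSym k U →ₐ[k] ⨁ d, deg k U d :=
  lift (A := ⨁ d, deg k U d) toDirectSumι (by
      intro i j x y
      change DirectSum.of (fun d => deg k U d) i ⟨ι U i x, ι_mem_deg i x⟩ *
        DirectSum.of (fun d => deg k U d) j ⟨ι U j y, ι_mem_deg j y⟩ = (-1 : ℤˣ) ^ (i * j) •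
        (DirectSum.of (fun d => deg k U d) j ⟨ι U j y, ι_mem_deg j y⟩ *
        DirectSum.of (fun d => deg k U d) i ⟨ι U i x, ι_mem_deg i x⟩)
      rw [DirectSum.of_mul_of, DirectSum.of_mul_of]
      have h := ι_comm (k := k) U i j x y
      rcases Int.units_eq_one_or ((-1 : ℤˣ) ^ (i * j)) with hs | hs
      · rw [hs, one_smul] at h ⊢
        exact DirectSum.of_eq_of_gradedMonoid_eq (Sigma.subtype_ext (add_comm i j) h)
      · rw [hs] at h ⊢
        have e : ∀ z : ⨁ d, deg k U d, (-1 : ℤˣ) • z = -z := fun z => by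
          rw [Units.smul_def]
          exact neg_one_zsmul z
        rw [e]
        rw [Units.smul_def, Units.val_neg, Units.val_one, neg_one_zsmul] at h
        rw [← map_neg]
        exact DirectSum.of_eq_of_gradedMonoid_eq (Sigma.subtype_ext (add_comm i j) h))

theorem toDirectSum_ι (i : ℤ) (x : U i) : toDirectSum (ι U i x : GrSym k U) =
    DirectSum.of (fun d => deg k U d) i ⟨ι U i x, ι_mem_deg i x⟩ :=
  lift_ι (A := ⨁ d, deg k U d) _ _ i x

theorem toDirectSum_word (l : List (Σ i, U i)) : toDirectSum (word l : GrSym k U) =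
    DirectSum.of (fun d => deg k U d) (wordDeg l) ⟨word l, word_mem_deg l⟩ := by
  induction l with
  | nil => exact map_one _
  | cons p l ih =>
    have h : toDirectSum (word (p :: l) : GrSym k U) = toDirectSum (ι U p.1 p.2 * word l) := by
      rw [word_cons]
    rw [h, map_mul, ih, toDirectSum_ι, DirectSum.of_mul_of]
    exact DirectSum.of_eq_of_gradedMonoid_eq
      (Sigma.subtype_ext (wordDeg_cons p l).symm (word_cons p l).symm)

instance gradedAlgebra : GradedAlgebra (deg k U) :=
  GradedAlgebra.ofAlgHom (deg k U) toDirectSum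
    (by
      refine algHom_ext' fun i x => ?_
      rw [AlgHom.comp_apply, toDirectSum_ι, DirectSum.coeAlgHom_of]
      rfl)
    (by
      rintro d ⟨x, hx⟩
      change toDirectSum x = _
      have key : ∀ y (hy : y ∈ deg k U d),
          toDirectSum y = DirectSum.lof k ℤ (fun d => deg k U d) d ⟨y, hy⟩ := by
        intro y hy
        rw [deg] at hy
        induction hy using Submodule.span_induction with
        | zero => rw [map_zero]; exact (map_zero _).symm
        | add a b ha hb iha ihb =>
          rw [map_add, iha ha, ihb hb, ← map_add]
          rfl
        | smul c a ha iha =>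
          rw [map_smul, iha ha, ← map_smul]
          rfl
        | mem a ha =>
          obtain ⟨l, rfl, rfl⟩ := ha
          exact toDirectSum_word l
      exact key x hx)

theorem span_words : Submodule.span k (Set.range (word : List (Σ i, U i) → GrSym k U)) = ⊤ := by
  have h : (⨆ d, deg k U d) = ⊤ :=
    (DirectSum.Decomposition.isInternal (deg k U)).submodule_iSup_eq_top
  rw [eq_top_iff, ← h]
  refine iSup_le fun d => Submodule.span_mono ?_
  rintro _ ⟨l, -, rfl⟩
  exact ⟨l, rfl⟩

/-- Linear maps out of `S(U)` are determined by their values on products of generators. -/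
theorem linearMap_ext_word {M : Type*} [AddCommGroup M] [Module k M] {f g : GrSym k U →ₗ[k] M}
    (h : ∀ l, f (word l) = g (word l)) : f = g :=
  LinearMap.ext_on span_words (by rintro _ ⟨l, rfl⟩; exact h l)

theorem mul_comm_deg (i j : ℤ) (a : GrSym k U) (ha : a ∈ deg k U i) (b : GrSym k U)
    (hb : b ∈ deg k U j) : a * b = (-1 : ℤˣ) ^ (i * j) • (b * a) := by
  have key : ∀ (l : List (Σ i, U i)) (j : ℤ) (y : U j),
      (word l * ι U j y : GrSym k U) = (-1 : ℤˣ) ^ (wordDeg l * j) • (ι U j y * word l) := by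
    intro l j y
    induction l with
    | nil =>
      rw [word_nil, one_mul, mul_one, wordDeg, List.map_nil, List.sum_nil, zero_mul, uzpow_zero,
        one_smul]
    | cons p l ih =>
      rw [word_cons, mul_assoc, ih, mul_smul_comm, ← mul_assoc, ι_comm, smul_mul_assoc, smul_smul,
        mul_assoc, wordDeg_cons, add_mul, uzpow_add, mul_comm]
  have key2 : ∀ (l l' : List (Σ i, U i)),
      (word l * word l' : GrSym k U) = (-1 : ℤˣ) ^ (wordDeg l * wordDeg l') •
        (word l' * word l) := by
    intro l l'
    induction l' with
    | nil =>
      rw [word_nil, one_mul, mul_one, wordDeg, wordDeg, List.map_nil, List.sum_nil, mul_zero,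
        uzpow_zero, one_smul]
    | cons p l' ih =>
      rw [word_cons, ← mul_assoc, key, smul_mul_assoc, mul_assoc, ih, mul_smul_comm, smul_smul,
        mul_assoc, wordDeg_cons, mul_add, uzpow_add]
  rw [deg] at ha hb
  induction ha using Submodule.span_induction with
  | zero => simp
  | add x y _ _ hx hy => rw [add_mul, mul_add, hx, hy, smul_add]
  | smul c x _ hx => rw [smul_mul_assoc, mul_smul_comm, hx, smul_comm]
  | mem x hx =>
    obtain ⟨l, rfl, rfl⟩ := hx
    induction hb using Submodule.span_induction with
    | zero => simp
    | add x y _ _ hx hy => rw [add_mul, mul_add, hx, hy, smul_add]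
    | smul c x _ hx => rw [smul_mul_assoc, mul_smul_comm, hx, smul_comm]
    | mem x hx =>
      obtain ⟨l', rfl, rfl⟩ := hx
      exact key2 l l'

/-- The comultiplication of `S(U)` as an algebra map into the graded tensor square of `S(U)`: it
is determined by `u ↦ u ⊗ 1 + 1 ⊗ u` for `u ∈ U`. -/
def comulAlgHom : GrSym k U →ₐ[k] GradedTensorProduct k (deg k U) (deg k U) :=
  lift (fun i => (GradedTensorProduct.of k (deg k U) (deg k U)).toLinearMap ∘ₗ
    ((TensorProduct.mk k (GrSym k U) (GrSym k U)).flip 1 +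
      TensorProduct.mk k (GrSym k U) (GrSym k U) 1) ∘ₗ ι U i) (by
    intro i j x y
    have h : ∀ (i : ℤ) (x : U i), ((GradedTensorProduct.of k (deg k U) (deg k U)).toLinearMap ∘ₗ
      ((TensorProduct.mk k (GrSym k U) (GrSym k U)).flip 1 +
      TensorProduct.mk k (GrSym k U) (GrSym k U) 1) ∘ₗ ι U i) x =
        GradedTensorProduct.tmul k (ι U i x) 1 + GradedTensorProduct.tmul k 1 (ι U i x) :=
      fun i x => rfl
    have h11 := fun {i₂ : ℤ} => GradedTensorProduct.tmul_one_mul_coe_tmul (R := k) (i₂ := i₂) (deg k U) (deg k U)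
    have h12 := GradedTensorProduct.tmul_one_mul_one_tmul (R := k) (deg k U) (deg k U)
    have h21 := fun {j₁ i₂ : ℤ} => GradedTensorProduct.tmul_coe_mul_coe_tmul (R := k) (j₁ := j₁) (i₂ := i₂) (deg k U) (deg k U)
    have h22 := fun {j₁ : ℤ} => GradedTensorProduct.tmul_coe_mul_one_tmul (R := k) (j₁ := j₁) (deg k U) (deg k U)
    rw [h, h]
    simp only [mul_add, add_mul]
    rw [h11 _ ⟨ι U j y, ι_mem_deg j y⟩ 1, h11 _ ⟨ι U i x, ι_mem_deg i x⟩ 1, h12, h12,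
      h21 1 ⟨ι U i x, ι_mem_deg i x⟩ ⟨ι U j y, ι_mem_deg j y⟩ 1,
      h21 1 ⟨ι U j y, ι_mem_deg j y⟩ ⟨ι U i x, ι_mem_deg i x⟩ 1,
      h22 1 ⟨ι U i x, ι_mem_deg i x⟩, h22 1 ⟨ι U j y, ι_mem_deg j y⟩]
    simp only [one_mul, mul_one, smul_add, smul_smul]
    have hs : (-1 : ℤˣ) ^ (i * j) * (-1 : ℤˣ) ^ (j * i) = 1 := by
      rw [_root_.mul_comm j i, Int.units_mul_self]
    have hc := ι_comm (k := k) U i j x y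
    rw [hs, one_smul, hc]
    simp only [units_smul_eq (k := k), GradedTensorProduct.tmul, TensorProduct.tmul_smul,
      ← TensorProduct.smul_tmul', map_smul]
    abel)

theorem comulAlgHom_ι (i : ℤ) (x : U i) : comulAlgHom (ι U i x : GrSym k U) =
    GradedTensorProduct.tmul k (ι U i x) 1 + GradedTensorProduct.tmul k 1 (ι U i x) :=
  lift_ι _ _ i x

variable (k U) in
/-- The comultiplication of `S(U)`. -/
def comulₗ : GrSym k U →ₗ[k] GrSym k U ⊗[k] GrSym k U :=
  (GradedTensorProduct.of k (deg k U) (deg k U)).symm.toLinearMap ∘ₗ comulAlgHom.toLinearMap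

theorem of_comulₗ (s : GrSym k U) :
    GradedTensorProduct.of k (deg k U) (deg k U) (comulₗ k U s) = comulAlgHom s := rfl

variable (k U) in
/-- The counit of `S(U)`: the algebra map which vanishes on `U`. -/
def counitAlgHom : GrSym k U →ₐ[k] k := lift (fun _ => 0) (by simp)

theorem counitAlgHom_ι (i : ℤ) (x : U i) : counitAlgHom k U (ι U i x) = 0 :=
  lift_ι _ _ i x

/-- The sign `(-1)^n` as an element of `k`. -/
def ksign (k : Type u) [Field k] (n : ℤ) : k := (((-1 : ℤˣ) ^ n : ℤˣ) : ℤ)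

theorem ksign_add (m n : ℤ) : ksign k (m + n) = ksign k m * ksign k n := by
  rw [ksign, ksign, ksign, uzpow_add, Units.val_mul, Int.cast_mul]

theorem ksign_zero : ksign k 0 = 1 := by
  rw [ksign, uzpow_zero, Units.val_one, Int.cast_one]

variable (k U) in
/-- The algebra automorphism of `S(U)` multiplying elements of degree `d` by `(-1)^{i d}`. -/
def par (i : ℤ) : GrSym k U →ₐ[k] GrSym k U :=
  lift (fun j => ksign k (i * j) • ι U j) (by
    intro a b x y
    simp only [LinearMap.smul_apply, smul_mul_assoc, mul_smul_comm]
    rw [ι_comm, units_smul_eq (k := k), units_smul_eq (k := k)]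
    simp only [smul_smul]
    congr 1
    ring)

theorem par_ι (i j : ℤ) (x : U j) : par k U i (ι U j x) = ksign k (i * j) • ι U j x :=
  lift_ι _ _ j x

theorem par_word (i : ℤ) (l : List (Σ i, U i)) :
    par k U i (word l) = ksign k (i * wordDeg l) • word l := by
  induction l with
  | nil => rw [word_nil, map_one, wordDeg, List.map_nil, List.sum_nil, mul_zero, ksign_zero,
      one_smul]
  | cons p l ih =>
    rw [word_cons, map_mul, ih, par_ι, wordDeg_cons, mul_add, ksign_add, smul_mul_assoc,
      mul_smul_comm, smul_smul]

theorem par_of_mem (i d : ℤ) (a : GrSym k U) (ha : a ∈ deg k U d) :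
    par k U i a = ksign k (i * d) • a := by
  rw [deg] at ha
  induction ha using Submodule.span_induction with
  | zero => simp
  | add x y _ _ hx hy => rw [map_add, smul_add, hx, hy]
  | smul c x _ hx => rw [map_smul, hx, smul_comm]
  | mem x hx =>
    obtain ⟨l, rfl, rfl⟩ := hx
    exact par_word i l

variable (k) in
/-- Left multiplication by `u ⊗ 1 + 1 ⊗ u` on the tensor square. -/
def stepOp (i : ℤ) (x : U i) : GrSym k U ⊗[k] GrSym k U →ₗ[k] GrSym k U ⊗[k] GrSym k U :=
  TensorProduct.map (LinearMap.mulLeft k (ι U i x)) LinearMap.id +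
    TensorProduct.map (par k U i).toLinearMap (LinearMap.mulLeft k (ι U i x))

theorem stepOp_tmul (i : ℤ) (x : U i) (a b : GrSym k U) :
    stepOp k i x (a ⊗ₜ b) = (ι U i x * a) ⊗ₜ b + par k U i a ⊗ₜ (ι U i x * b) := rfl

theorem comulₗ_one : comulₗ k U 1 = 1 ⊗ₜ 1 := by
  change (GradedTensorProduct.of k (deg k U) (deg k U)).symm (comulAlgHom 1) = _
  rw [map_one]
  rfl

theorem of_stepOp (i : ℤ) (x : U i) (t : GrSym k U ⊗[k] GrSym k U) :
    GradedTensorProduct.of k (deg k U) (deg k U) (stepOp k i x t) =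
      (GradedTensorProduct.tmul k (ι U i x) 1 + GradedTensorProduct.tmul k 1 (ι U i x)) *
        GradedTensorProduct.of k (deg k U) (deg k U) t := by
  induction t with
  | zero => simp
  | add a b ha hb => rw [map_add, map_add, map_add, mul_add, ha, hb]
  | tmul a b =>
    have ha : a ∈ ⨆ d, deg k U d := by
      rw [(DirectSum.Decomposition.isInternal (deg k U)).submodule_iSup_eq_top]
      trivial
    induction ha using Submodule.iSup_induction' with
    | zero => simp
    | add a a' _ _ h h' =>
      rw [TensorProduct.add_tmul, map_add, map_add, map_add, mul_add, h, h']
    | mem d a ha =>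
      rw [stepOp_tmul, add_mul, map_add]
      congr 1
      · exact (GradedTensorProduct.tmul_one_mul_coe_tmul (R := k) (deg k U) (deg k U)
          (ι U i x) ⟨a, ha⟩ b).symm
      · have h := GradedTensorProduct.tmul_coe_mul_coe_tmul (R := k) (deg k U) (deg k U)
          1 ⟨ι U i x, ι_mem_deg i x⟩ ⟨a, ha⟩ b
        rw [one_mul, units_smul_eq (k := k)] at h
        refine Eq.trans ?_ h.symm
        rw [par_of_mem i d a ha, ← TensorProduct.smul_tmul', map_smul]
        rfl

theorem comulₗ_ι_mul (i : ℤ) (x : U i) (s : GrSym k U) :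
    comulₗ k U (ι U i x * s) = stepOp k i x (comulₗ k U s) := by
  apply (GradedTensorProduct.of k (deg k U) (deg k U)).injective
  rw [of_stepOp, of_comulₗ, of_comulₗ, map_mul, comulAlgHom_ι]

theorem comulₗ_word_cons (p : Σ i, U i) (l : List (Σ i, U i)) :
    comulₗ k U (word (p :: l)) = stepOp k p.1 p.2 (comulₗ k U (word l)) := by
  rw [word_cons, comulₗ_ι_mul]

theorem comulₗ_mem (d : ℤ) (s : GrSym k U) (hs : s ∈ deg k U d) :
    comulₗ k U s ∈ tensorDeg (deg k U) (deg k U) d := by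
  have hstep : ∀ (i : ℤ) (x : U i) (e : ℤ) (t : GrSym k U ⊗[k] GrSym k U),
      t ∈ tensorDeg (deg k U) (deg k U) e →
      stepOp k i x t ∈ tensorDeg (deg k U) (deg k U) (i + e) := by
    intro i x e t ht
    rw [tensorDeg] at ht
    induction ht using Submodule.span_induction with
    | zero => rw [map_zero]; exact zero_mem _
    | add a b _ _ ha hb => rw [map_add]; exact add_mem ha hb
    | smul c a _ ha => rw [map_smul]; exact Submodule.smul_mem _ _ ha
    | mem t ht =>
      obtain ⟨p, q, a, ha, b, hb, rfl, rfl⟩ := ht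
      rw [stepOp_tmul]
      refine add_mem (Submodule.subset_span ?_) (Submodule.subset_span ?_)
      · exact ⟨i + p, q, _, SetLike.mul_mem_graded (ι_mem_deg i x) ha, b, hb, by ring, rfl⟩
      · refine ⟨p, i + q, _, ?_, _, SetLike.mul_mem_graded (ι_mem_deg i x) hb, by ring, rfl⟩
        rw [par_of_mem i p a ha]
        exact Submodule.smul_mem _ _ ha
  rw [deg] at hs
  induction hs using Submodule.span_induction with
  | zero => rw [map_zero]; exact zero_mem _
  | add a b _ _ ha hb => rw [map_add]; exact add_mem ha hb
  | smul c a _ ha => rw [map_smul]; exact Submodule.smul_mem _ _ ha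
  | mem s hs =>
    obtain ⟨l, rfl, rfl⟩ := hs
    induction l with
    | nil =>
      rw [word_nil, comulₗ_one]
      exact Submodule.subset_span ⟨0, 0, 1, SetLike.one_mem_graded _, 1,
        SetLike.one_mem_graded _, rfl, rfl⟩
    | cons p l ih =>
      rw [comulₗ_word_cons, wordDeg_cons]
      exact hstep _ _ _ _ ih

theorem comulₗ_par (i : ℤ) (s : GrSym k U) : comulₗ k U (par k U i s) =
    TensorProduct.map (par k U i).toLinearMap (par k U i).toLinearMap (comulₗ k U s) := by
  have h : comulₗ k U ∘ₗ (par k U i).toLinearMap =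
      TensorProduct.map (par k U i).toLinearMap (par k U i).toLinearMap ∘ₗ comulₗ k U := by
    refine linearMap_ext_word fun l => ?_
    have hm := comulₗ_mem _ _ (word_mem_deg (k := k) l)
    rw [LinearMap.comp_apply, LinearMap.comp_apply, AlgHom.toLinearMap_apply, par_word, map_smul]
    generalize comulₗ k U (word l) = t at hm
    rw [tensorDeg] at hm
    induction hm using Submodule.span_induction with
    | zero => rw [map_zero, smul_zero]
    | add a b _ _ ha hb => rw [map_add, smul_add, ha, hb]
    | smul c a _ ha => rw [map_smul, smul_comm, ha]
    | mem t ht =>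
      obtain ⟨p, q, a, ha, b, hb, hpq, rfl⟩ := ht
      rw [TensorProduct.map_tmul, AlgHom.toLinearMap_apply, AlgHom.toLinearMap_apply,
        par_of_mem i p a ha, par_of_mem i q b hb, TensorProduct.tmul_smul,
        ← TensorProduct.smul_tmul', smul_smul, ← hpq, mul_add, ksign_add, _root_.mul_comm]
  exact LinearMap.congr_fun h s

theorem counit_par (i : ℤ) (s : GrSym k U) : counitAlgHom k U (par k U i s) = counitAlgHom k U s := by
  have h : (counitAlgHom k U).comp (par k U i) = counitAlgHom k U := algHom_ext' fun j x => by
    rw [AlgHom.comp_apply, par_ι, map_smul, counitAlgHom_ι, smul_zero]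
  exact DFunLike.congr_fun h s

theorem coassoc_word (l : List (Σ i, U i)) :
    TensorProduct.assoc k _ _ _ ((comulₗ k U).rTensor _ (comulₗ k U (word l))) =
      (comulₗ k U).lTensor _ (comulₗ k U (word l)) := by
  induction l with
  | nil => rw [word_nil, comulₗ_one, LinearMap.rTensor_tmul, LinearMap.lTensor_tmul, comulₗ_one,
      TensorProduct.assoc_tmul]
  | cons p l ih =>
    obtain ⟨i, x⟩ := p
    let Ω : GrSym k U ⊗[k] (GrSym k U ⊗[k] GrSym k U) →ₗ[k]
        GrSym k U ⊗[k] (GrSym k U ⊗[k] GrSym k U) :=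
      TensorProduct.map (LinearMap.mulLeft k (ι U i x)) LinearMap.id +
        TensorProduct.map (par k U i).toLinearMap (stepOp k i x)
    have h1 : ∀ t, TensorProduct.assoc k _ _ _ ((comulₗ k U).rTensor _ (stepOp k i x t)) =
        Ω (TensorProduct.assoc k _ _ _ ((comulₗ k U).rTensor _ t)) := by
      intro t
      induction t with
      | zero => simp only [map_zero]
      | add a b ha hb => simp only [map_add, ha, hb]
      | tmul a b =>
        rw [stepOp_tmul, map_add, LinearMap.rTensor_tmul, LinearMap.rTensor_tmul, comulₗ_ι_mul,
          comulₗ_par, LinearMap.rTensor_tmul]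
        induction comulₗ k U a with
        | zero => simp only [map_zero, TensorProduct.zero_tmul, add_zero]
        | add c d hc hd =>
          simp only [map_add, TensorProduct.add_tmul] at hc hd ⊢
          rw [← hc, ← hd]
          abel
        | tmul c d =>
          simp only [stepOp_tmul, TensorProduct.add_tmul, map_add, TensorProduct.assoc_tmul,
            TensorProduct.map_tmul, AlgHom.toLinearMap_apply, Ω, LinearMap.add_apply,
            LinearMap.mulLeft_apply, LinearMap.id_apply, TensorProduct.tmul_add]
          abel
    have h2 : ∀ t, (comulₗ k U).lTensor _ (stepOp k i x t) = Ω ((comulₗ k U).lTensor _ t) := by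
      intro t
      induction t with
      | zero => simp only [map_zero]
      | add a b ha hb => simp only [map_add, ha, hb]
      | tmul a b =>
        rw [stepOp_tmul, map_add, LinearMap.lTensor_tmul, LinearMap.lTensor_tmul, comulₗ_ι_mul,
          LinearMap.lTensor_tmul]
        rfl
    rw [comulₗ_word_cons, h1, h2, ih]

instance coalgebra : Coalgebra k (GrSym k U) where
  comul := comulₗ k U
  counit := (counitAlgHom k U).toLinearMap
  coassoc := linearMap_ext_word coassoc_word
  rTensor_counit_comp_comul := by
    refine linearMap_ext_word fun l => ?_
    rw [LinearMap.comp_apply, TensorProduct.mk_apply]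
    induction l with
    | nil => rw [word_nil, comulₗ_one, LinearMap.rTensor_tmul, AlgHom.toLinearMap_apply, map_one]
    | cons p l ih =>
      rw [comulₗ_word_cons, word_cons]
      have h : ∀ t, (counitAlgHom k U).toLinearMap.rTensor _ (stepOp k p.1 p.2 t) =
          (LinearMap.mulLeft k (ι U p.1 p.2)).lTensor k
            ((counitAlgHom k U).toLinearMap.rTensor _ t) := by
        intro t
        induction t with
        | zero => simp only [map_zero]
        | add a b ha hb => simp only [map_add, ha, hb]
        | tmul a b =>
          simp only [stepOp_tmul, map_add, LinearMap.rTensor_tmul, LinearMap.lTensor_tmul,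
            AlgHom.toLinearMap_apply, map_mul, counitAlgHom_ι, zero_mul, TensorProduct.zero_tmul,
            zero_add, counit_par, LinearMap.mulLeft_apply]
      rw [h, ih, LinearMap.lTensor_tmul, LinearMap.mulLeft_apply]
  lTensor_counit_comp_comul := by
    refine linearMap_ext_word fun l => ?_
    rw [LinearMap.comp_apply, LinearMap.flip_apply, TensorProduct.mk_apply]
    induction l with
    | nil => rw [word_nil, comulₗ_one, LinearMap.lTensor_tmul, AlgHom.toLinearMap_apply, map_one]
    | cons p l ih =>
      rw [comulₗ_word_cons, word_cons]
      have h : ∀ t, (counitAlgHom k U).toLinearMap.lTensor _ (stepOp k p.1 p.2 t) =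
          (LinearMap.mulLeft k (ι U p.1 p.2)).rTensor k
            ((counitAlgHom k U).toLinearMap.lTensor _ t) := by
        intro t
        induction t with
        | zero => simp only [map_zero]
        | add a b ha hb => simp only [map_add, ha, hb]
        | tmul a b =>
          simp only [stepOp_tmul, map_add, LinearMap.rTensor_tmul, LinearMap.lTensor_tmul,
            AlgHom.toLinearMap_apply, map_mul, counitAlgHom_ι, zero_mul, TensorProduct.tmul_zero,
            add_zero, LinearMap.mulLeft_apply]
      rw [h, ih, LinearMap.rTensor_tmul, LinearMap.mulLeft_apply]

theorem comul_def (s : GrSym k U) : (Coalgebra.comul s : GrSym k U ⊗[k] GrSym k U) = comulₗ k U s :=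
  rfl

theorem counit_def (s : GrSym k U) : Coalgebra.counit (R := k) s = counitAlgHom k U s := rfl

theorem counit_deg (d : ℤ) (hd : d ≠ 0) (s : GrSym k U) (hs : s ∈ deg k U d) :
    counitAlgHom k U s = 0 := by
  rw [deg] at hs
  induction hs using Submodule.span_induction with
  | zero => exact map_zero _
  | add a b _ _ ha hb => rw [map_add, ha, hb, add_zero]
  | smul c a _ ha => rw [map_smul, ha, smul_zero]
  | mem s hs =>
    obtain ⟨l, rfl, rfl⟩ := hs
    cases l with
    | nil => exact absurd rfl hd
    | cons p l => rw [word_cons, map_mul, counitAlgHom_ι, zero_mul]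

theorem cocomm (s : GrSym k U) :
    GradedTensorProduct.comm (deg k U) (deg k U) (comulAlgHom s) = comulAlgHom s := by
  have h : (GradedTensorProduct.comm (deg k U) (deg k U)).toAlgHom.comp comulAlgHom =
      (comulAlgHom : GrSym k U →ₐ[k] _) := by
    refine algHom_ext' fun i x => ?_
    have h1 := GradedTensorProduct.comm_coe_tmul_coe (R := k) (deg k U) (deg k U)
      ⟨ι U i x, ι_mem_deg i x⟩ ⟨1, SetLike.one_mem_graded _⟩
    have h2 := GradedTensorProduct.comm_coe_tmul_coe (R := k) (deg k U) (deg k U)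
      ⟨1, SetLike.one_mem_graded _⟩ ⟨ι U i x, ι_mem_deg i x⟩
    rw [zero_mul, uzpow_zero, one_smul] at h1
    rw [mul_zero, uzpow_zero, one_smul] at h2
    change GradedTensorProduct.comm (deg k U) (deg k U) (comulAlgHom (ι U i x)) = _
    rw [comulAlgHom_ι, map_add, h1, h2, add_comm]
  exact DFunLike.congr_fun h s

/-- The span of the products of fewer than `n` generators. -/
def lowWords (k : Type u) [Field k] (U : ℤ → Type v) [∀ i, AddCommGroup (U i)]
    [∀ i, Module k (U i)] (n : ℕ) : Submodule k (GrSym k U) :=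
  Submodule.span k {s | ∃ l : List (Σ i, U i), l.length < n ∧ s = word l}

/-- The span of the `a ⊗ b` with `a` a product of fewer than `n` generators. -/
def lowTensors (k : Type u) [Field k] (U : ℤ → Type v) [∀ i, AddCommGroup (U i)]
    [∀ i, Module k (U i)] (n : ℕ) : Submodule k (GrSym k U ⊗[k] GrSym k U) :=
  Submodule.span k {t | ∃ l : List (Σ i, U i), l.length < n ∧ ∃ b, t = word l ⊗ₜ b}

theorem lowTensors_mono {m n : ℕ} (h : m ≤ n) : lowTensors k U m ≤ lowTensors k U n := by
  refine Submodule.span_mono ?_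
  rintro _ ⟨l, hl, b, rfl⟩
  exact ⟨l, hl.trans_le h, b, rfl⟩

theorem lowWords_mono {m n : ℕ} (h : m ≤ n) : lowWords k U m ≤ lowWords k U n := by
  refine Submodule.span_mono ?_
  rintro _ ⟨l, hl, rfl⟩
  exact ⟨l, hl.trans_le h, rfl⟩

theorem comulₗ_word_sub_mem (l : List (Σ i, U i)) :
    comulₗ k U (word l) - word l ⊗ₜ 1 ∈ lowTensors k U l.length := by
  induction l with
  | nil =>
    rw [word_nil (k := k) (U := U), comulₗ_one, sub_self]
    exact zero_mem _
  | cons p l ih =>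
    let P := TensorProduct.map (LinearMap.mulLeft k (ι (k := k) U p.1 p.2)) (LinearMap.id (M := GrSym k U))
    let Q := TensorProduct.map (par k U p.1).toLinearMap (LinearMap.mulLeft k (ι (k := k) U p.1 p.2))
    have hP : ∀ t n, t ∈ lowTensors k U n → P t ∈ lowTensors k U (n + 1) := by
      intro t n ht
      rw [lowTensors] at ht
      induction ht using Submodule.span_induction with
      | zero => rw [map_zero]; exact zero_mem _
      | add a b _ _ ha hb => rw [map_add]; exact add_mem ha hb
      | smul c a _ ha => rw [map_smul]; exact Submodule.smul_mem _ _ ha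
      | mem t ht =>
        obtain ⟨l, hl, b, rfl⟩ := ht
        refine Submodule.subset_span ⟨p :: l, by rw [List.length_cons]; omega, b, ?_⟩
        rw [word_cons]
        rfl
    have hQ : ∀ t n, t ∈ lowTensors k U n → Q t ∈ lowTensors k U n := by
      intro t n ht
      rw [lowTensors] at ht
      induction ht using Submodule.span_induction with
      | zero => rw [map_zero]; exact zero_mem _
      | add a b _ _ ha hb => rw [map_add]; exact add_mem ha hb
      | smul c a _ ha => rw [map_smul]; exact Submodule.smul_mem _ _ ha
      | mem t ht =>
        obtain ⟨l, hl, b, rfl⟩ := ht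
        rw [TensorProduct.map_tmul, AlgHom.toLinearMap_apply, par_word,
          ← TensorProduct.smul_tmul']
        exact Submodule.smul_mem _ _ (Submodule.subset_span ⟨l, hl, _, rfl⟩)
    have h1 : comulₗ k U (word l) ∈ lowTensors k U (l.length + 1) := by
      rw [← sub_add_cancel (comulₗ k U (word l)) (word l ⊗ₜ 1)]
      exact add_mem (lowTensors_mono (Nat.le_succ _) ih)
        (Submodule.subset_span ⟨l, Nat.lt_succ_self _, 1, rfl⟩)
    have h2 : comulₗ k U (word (p :: l)) - word (p :: l) ⊗ₜ 1 =
        P (comulₗ k U (word l) - word l ⊗ₜ 1) + Q (comulₗ k U (word l)) := by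
      rw [comulₗ_word_cons, map_sub]
      change P _ + Q _ - _ = P _ - (ι U p.1 p.2 * word l) ⊗ₜ[k] 1 + Q _
      rw [word_cons]
      abel
    rw [h2, List.length_cons]
    exact add_mem (hP _ _ ih) (hQ _ _ h1)

theorem redComul_mem (m : ℕ) (s : GrSym k U) (hs : s ∈ lowWords k U (m + 1)) :
    redComul k (GrSym k U) s ∈ lowTensors k U m := by
  rw [lowWords] at hs
  induction hs using Submodule.span_induction with
  | zero => rw [map_zero]; exact zero_mem _
  | add a b _ _ ha hb => rw [map_add]; exact add_mem ha hb
  | smul c a _ ha => rw [map_smul]; exact Submodule.smul_mem _ _ ha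
  | mem s hs =>
    obtain ⟨l, hl, rfl⟩ := hs
    refine lowTensors_mono (Nat.lt_succ_iff.mp hl) ?_
    have h : redComul k (GrSym k U) (word l) = (comulₗ k U (word l) - word l ⊗ₜ 1) - 1 ⊗ₜ word l +
      counitAlgHom k U (word l) • (1 ⊗ₜ[k] 1) := rfl
    rw [h]
    cases l with
    | nil =>
      rw [word_nil, comulₗ_one, map_one, one_smul, sub_self, zero_sub, neg_add_cancel]
      exact zero_mem _
    | cons p l =>
      refine add_mem (sub_mem (comulₗ_word_sub_mem _) (Submodule.subset_span ?_))
        (Submodule.smul_mem _ _ (Submodule.subset_span ?_)) <;>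
      exact ⟨[], by simp, _, by rw [word_nil]⟩

theorem redComulIter_eq_zero (m : ℕ) : ∀ s ∈ lowWords k U m,
    redComulIter k (GrSym k U) m s = 0 := by
  induction m with
  | zero =>
    intro s hs
    have h : lowWords k U 0 = ⊥ := by
      rw [lowWords, Submodule.span_eq_bot]
      rintro _ ⟨l, hl, -⟩
      omega
    rw [h, Submodule.mem_bot] at hs
    rw [hs, map_zero]
  | succ m ih =>
    intro s hs
    have h := redComul_mem m s hs
    rw [redComulIter, LinearMap.comp_apply, LinearMap.comp_apply]
    generalize redComul k (GrSym k U) s = t at h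
    rw [lowTensors] at h
    induction h using Submodule.span_induction with
    | zero => simp only [map_zero]
    | add a b _ _ ha hb => simp only [map_add, ha, hb, add_zero]
    | smul c a _ ha => simp only [map_smul, ha, smul_zero]
    | mem t ht =>
      obtain ⟨l, hl, b, rfl⟩ := ht
      rw [TensorProduct.map_tmul, LinearMap.mul'_apply, ih _ (Submodule.subset_span ⟨l, hl, rfl⟩),
        zero_mul]

theorem conilpotent (s : GrSym k U) : ∃ K, ∀ m ≥ K, redComulIter k (GrSym k U) m s = 0 := by
  have h : s ∈ Submodule.span k (Set.range (word : List (Σ i, U i) → GrSym k U)) := by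
    rw [span_words]
    trivial
  suffices ∃ K, s ∈ lowWords k U K by
    obtain ⟨K, hK⟩ := this
    exact ⟨K, fun m hm => redComulIter_eq_zero m s (lowWords_mono hm hK)⟩
  induction h using Submodule.span_induction with
  | zero => exact ⟨0, zero_mem _⟩
  | add a b _ _ ha hb =>
    obtain ⟨K, hK⟩ := ha
    obtain ⟨L, hL⟩ := hb
    exact ⟨max K L, add_mem (lowWords_mono (le_max_left _ _) hK)
      (lowWords_mono (le_max_right _ _) hL)⟩
  | smul c a _ ha =>
    obtain ⟨K, hK⟩ := ha
    exact ⟨K, Submodule.smul_mem _ _ hK⟩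
  | mem s hs =>
    obtain ⟨l, rfl⟩ := hs
    exact ⟨l.length + 1, Submodule.subset_span ⟨l, Nat.lt_succ_self _, rfl⟩⟩

end GrSym

end GrSym

section IBL

variable {k : Type u} [Field k]

/-- `IsDiffOpAux deg n d D`, for an operator `D` of degree `d` on a graded algebra: all `n`-fold
iterated graded commutators `[[⋯[D, L_{a₁}], ⋯], L_{aₙ}]` with left multiplications vanish, where
`[D, L_a] = D ∘ L_a - (-1)^{|D||a|} L_a ∘ D`. -/
def IsDiffOpAux {V : Type v} [Ring V] [Algebra k V] (deg : ℤ → Submodule k V) :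
    ℕ → ℤ → (V →ₗ[k] V) → Prop
  | 0, _, D => D = 0
  | n + 1, d, D => ∀ i : ℤ, ∀ a ∈ deg i, IsDiffOpAux deg n (d + i)
      (D ∘ₗ LinearMap.mulLeft k a - (-1 : ℤˣ) ^ (d * i) • (LinearMap.mulLeft k a ∘ₗ D))

/-- `D`, of degree `d`, is a differential operator of order at most `r`: its graded commutators
with any `r + 1` left multiplications vanish. -/
def IsDiffOp {V : Type v} [Ring V] [Algebra k V] (deg : ℤ → Submodule k V) (r : ℕ) (d : ℤ)
    (D : V →ₗ[k] V) : Prop := IsDiffOpAux deg (r + 1) d D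

/-- The component `F_j : V → W` of a `k⟦ℏ⟧`-linear map
`F = F_0 + ℏ F_1 + ℏ² F_2 + ⋯ : V⟦ℏ⟧ → W⟦ℏ⟧`. -/
def component {V : Type v} [Ring V] [Algebra k V] {W : Type w} [Ring W] [Algebra k W]
    (F : V⟦X⟧ →ₗ[k⟦X⟧] W⟦X⟧) (j : ℕ) : V →ₗ[k] W where
  toFun v := coeff j (F (C v))
  map_add' a b := by rw [map_add, map_add, map_add]
  map_smul' c a := by
    rw [← restr_apply, map_smul, PowerSeries.coeff_smul]
    rfl

variable (k) in
/-- `IBL_∞`-algebras: a graded vector space `U` with an operator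
`Δ = Δ₁ + ℏ Δ₂ + ℏ² Δ₃ + ⋯` on `S(U)⟦ℏ⟧` of degree one such that `Δ² = 0`, `Δ(1) = 0` and `Δⱼ` is a
differential operator of order at most `j`. -/
structure IBLAlg where
  /-- The graded vector space. -/
  U : ℤ → Type v
  [addCommGroup : ∀ i, AddCommGroup (U i)]
  [module : ∀ i, Module k (U i)]
  /-- The structure operator. -/
  Δ : (GrSym k U)⟦X⟧ →ₗ[k⟦X⟧] (GrSym k U)⟦X⟧
  Δ_deg : ∀ d : ℤ, ∀ v ∈ GrSym.deg k U d, ∀ n : ℕ, coeff n (Δ (C v)) ∈ GrSym.deg k U (d + 1)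
  Δ_sq : Δ ∘ₗ Δ = 0
  Δ_one : Δ 1 = 0
  /-- `component Δ j` is `Δ_{j+1}`. -/
  Δ_order : ∀ j : ℕ, IsDiffOp (GrSym.deg k U) (j + 1) 1 (component Δ j)

attribute [instance] IBLAlg.addCommGroup IBLAlg.module

/-- The MV-algebra `(S(U), μ, δ, Δ)` of an `IBL_∞`-algebra, with the standard bialgebra structure
on `S(U)`. -/
def IBLAlg.toMV (A : IBLAlg.{u, v} k) : MVAlg.{u, max u v} k where
  V := GrSym k A.U
  deg := GrSym.deg k A.U
  mul_comm := GrSym.mul_comm_deg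
  comul_mem := GrSym.comulₗ_mem
  counit_deg := GrSym.counit_deg
  cocomm := GrSym.cocomm
  comul_one := GrSym.comulₗ_one
  counit_one := map_one (GrSym.counitAlgHom k A.U)
  counit_mul := map_mul (GrSym.counitAlgHom k A.U)
  conilpotent := GrSym.conilpotent
  Δ := A.Δ
  Δ_deg := A.Δ_deg
  Δ_sq := A.Δ_sq
  Δ_one := A.Δ_one

/-- `IBL_∞`-morphisms `A → B`: the MV-morphisms `f = f^(1) + ℏ f^(2) + ℏ² f^(3) + ⋯` such that
`f^(1)(1) = 0` and `f^(r)` vanishes on `Sⁿ(U)` for `n > r`; `component f j` is `f^(j+1)`. -/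
structure IsIBLHom [CharZero k] {A B : IBLAlg.{u, v} k} (f : A.toMV ⟶ B.toMV) : Prop where
  map_one : component (MVAlg.Hom.toLin0 f).toLin 0 1 = 0
  map_symPow : ∀ j n : ℕ, j + 1 < n → ∀ x ∈ GrSym.symPow k A.U n,
    component (MVAlg.Hom.toLin0 f).toLin j x = 0

end IBL

end

open CategoryTheory

universe u v

/-!
Write a map `φ : S(U) → T⟦ℏ⟧` as having *weight* if it sends `Sⁿ(U)` into the multiples of
`ℏ ^ (n - 1)`.  Up to the normalisation on `1`, which is automatic, an `IBL_∞`-morphism is an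
MV-morphism that has weight, so the structure operators play no role: what has to be shown is that
`log id` has weight, and that `h = log (exp f ∘ exp g)` has weight if `f` and `g` do.

The basic tool is that left multiplication `L_u` by a generator `u` is a coderivation of `S(U)`, so
that `exp φ ∘ L_u = (φ ∘ L_u) ⋆ exp φ` (`GrSym.precomp_mulGen_convExp`); the exponential is
invertible, hence this determines `φ ∘ L_u`.  For `exp φ = id` it gives `φ(u s) = ε(s) u`.

For the composition, `S(W)` is regarded as a graded vector space of generators, with the
multiplication `μ̂ : S(S(W)) → S(W)`.  The *cumulant* of `F = exp f` is the map `κ` on `S(S(W))`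
with `exp κ = F ∘ μ̂`; its values `κ(a₁ • ⋯ • aₙ)` measure how far `F` is from being multiplicative.

* The cumulant has weight (`GrSym.IsCumulant.hasWeight`).  Cancelling `exp κ` in
  `F ∘ μ̂ ∘ L_{ab} = F ∘ μ̂ ∘ L_a ∘ L_b` gives
  `κ((ab) • s) = κ(a • b • s) + ∑ ± κ(a • s') κ(b • s'')`.  By induction this reduces the claim to
  products of words of length at most one.  There `κ` is `f`, except that it is trivial when some
  argument is `1`.
* The map `θ = exp g : S(U) → S(S(W))⟦ℏ⟧`, with the exponential now formed in `S(S(W))` so that `g`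
  takes its values in generators, is a map of coalgebras
  (`GrSym.isCompletedCoalgHom_convExp_emb`): its composite with the comultiplication is the
  exponential of a sum of two commuting maps.  Therefore
  `exp f ∘ exp g = F ∘ μ̂ ∘ θ = exp κ ∘ θ = exp (κ ∘ θ)`, that is, `h = κ ∘ θ`.
* On `Sⁿ(U)`, the component of `θ` in `Sᵐ(S(W))` is divisible by `ℏ ^ (n - m)`, and `κ` contributes
  `ℏ ^ (m - 1)`, so that `h` has weight.
-/

noncomputable section

open MVAlgebra

universe w x

/-! ### Convolution products of series-valued maps -/

namespace MVAlgebra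

section Convolution

variable {k : Type u} [Field k] {V : Type v} [AddCommGroup V] [Module k V]
  {W : Type w} [AddCommGroup W] [Module k W] {T : Type x} [Ring T] [Algebra k T]

/-- The composite `φ ∘ L` of an element of a convolution algebra with a linear map of sources. -/
def precomp (φ : WithConv (V →ₗ[k] T⟦X⟧)) (L : W →ₗ[k] V) : WithConv (W →ₗ[k] T⟦X⟧) :=
  toConv (φ.ofConv ∘ₗ L)

end Convolution

section EvalSeries

variable {k : Type u} [Field k] {V : Type v} [Ring V] [Algebra k V] [Coalgebra k V]
  {T : Type w} [Ring T] [Algebra k T]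

/-- Each coefficient of each value of `η * p(φ)` is a finite sum of those of the `pₘ (η * φ ^ m)`. -/
theorem coeff_mul_evalSeries (p : k⟦X⟧) {φ : WithConv (V →ₗ[k] T⟦X⟧)} (h : TopNilp φ)
    (η : WithConv (V →ₗ[k] T⟦X⟧)) (v : V) (n : ℕ) :
    ∃ M, ∀ K ≥ M, coeff n ((η * evalSeries p φ h) v) =
      ∑ m ∈ Finset.range K, coeff m p • coeff n ((η * φ ^ m) v) := by
  have hφ := h
  choose κ hκ using hφ
  let r := Coalgebra.Repr.arbitrary k v
  refine ⟨∑ i ∈ r.index, κ (r.right i) (n + 1), fun K hK => ?_⟩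
  have hi : ∀ i ∈ r.index, κ (r.right i) (n + 1) ≤ K := fun i hi =>
    (Finset.single_le_sum (f := fun i => κ (r.right i) (n + 1))
      (fun _ _ => Nat.zero_le _) hi).trans hK
  rw [coeff_conv_mul _ _ v n r]
  simp only [coeff_conv_mul _ _ v n r, Finset.smul_sum]
  simp only [Finset.sum_comm (s := Finset.range _) (t := r.index)]
  refine Finset.sum_congr rfl fun i hii => ?_
  simp only [Finset.sum_comm (s := Finset.range _) (t := Finset.HasAntidiagonal.antidiagonal n)]
  refine Finset.sum_congr rfl fun c hc => ?_
  rw [Finset.HasAntidiagonal.mem_antidiagonal] at hc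
  rw [coeff_evalSeries_eq_sum p h _ _ K fun m hm =>
    hκ (r.right i) (n + 1) m ((hi i hii).trans hm) _ (by omega), Finset.mul_sum]
  exact Finset.sum_congr rfl fun m _ => mul_smul_comm _ _ _

theorem isUnit_convExp [CharZero k] (φ : WithConv (V →ₗ[k] T⟦X⟧)) (h : TopNilp φ) :
    IsUnit (convExp φ h) := by
  have hc : constantCoeff (PowerSeries.exp k) ≠ 0 := by simp
  refine isUnit_iff_exists.mpr ⟨evalSeries (PowerSeries.exp k)⁻¹ φ h, ?_, ?_⟩
  · rw [convExp, ← evalSeries_mul, PowerSeries.mul_inv_cancel _ hc, evalSeries_one]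
  · rw [convExp, ← evalSeries_mul, PowerSeries.inv_mul_cancel _ hc, evalSeries_one]

/-- For topologically nilpotent `φ` and `ψ`, the products `φ ^ i * ψ ^ j` tend pointwise to zero as
`i` or `j` tends to infinity, uniformly in the other exponent. -/
theorem TopNilp.exists_mul_pow_eq_zero {φ ψ : WithConv (V →ₗ[k] T⟦X⟧)} (hφ : TopNilp φ)
    (hψ : TopNilp ψ) (v : V) (n : ℕ) :
    ∃ K, ∀ i j, K ≤ i ∨ K ≤ j → coeff n ((φ ^ i * ψ ^ j) v) = 0 := by
  choose κ hκ using hφ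
  choose κ' hκ' using hψ
  let r := Coalgebra.Repr.arbitrary k v
  refine ⟨∑ i ∈ r.index, (κ (r.left i) (n + 1) + κ' (r.right i) (n + 1)), fun i j hij => ?_⟩
  rw [coeff_conv_mul _ _ v n r]
  refine Finset.sum_eq_zero fun a ha => Finset.sum_eq_zero fun c hc => ?_
  have h1 := Finset.single_le_sum (f := fun i => κ (r.left i) (n + 1) + κ' (r.right i) (n + 1))
    (fun _ _ => Nat.zero_le _) ha
  rw [Finset.HasAntidiagonal.mem_antidiagonal] at hc
  rcases hij with h | h
  · rw [hκ (r.left a) (n + 1) i (by omega) _ (by omega), zero_mul]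
  · rw [hκ' (r.right a) (n + 1) j (by omega) _ (by omega), mul_zero]

theorem convExp_add [CharZero k] {φ ψ : WithConv (V →ₗ[k] T⟦X⟧)} (hc : Commute φ ψ)
    (hφ : TopNilp φ) (hψ : TopNilp ψ) (hs : TopNilp (φ + ψ)) :
    convExp (φ + ψ) hs = convExp φ hφ * convExp ψ hψ := by
  ext1
  refine LinearMap.ext fun v => PowerSeries.ext fun n => ?_
  obtain ⟨K, hK⟩ := hφ.exists_mul_pow_eq_zero hψ v n
  let c : ℕ × ℕ → T := fun p =>
    ((p.1.factorial : k)⁻¹ * (p.2.factorial : k)⁻¹) • coeff n ((φ ^ p.1 * ψ ^ p.2) v)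
  -- The term of degree `m` of `exp (φ + ψ)`, by the binomial theorem.
  have hpow : ∀ m, (coeff m (PowerSeries.exp k)) • coeff n (((φ + ψ) ^ m) v) =
      ∑ p ∈ Finset.HasAntidiagonal.antidiagonal m, c p := by
    intro m
    rw [hc.add_pow', ofConv_sum, LinearMap.sum_apply, map_sum, Finset.smul_sum]
    refine Finset.sum_congr rfl fun p hp => ?_
    rw [Finset.HasAntidiagonal.mem_antidiagonal] at hp
    rw [ofConv_smul, LinearMap.smul_apply, map_nsmul, ← Nat.cast_smul_eq_nsmul k, smul_smul]
    congr 1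
    have h1 : (p.1.factorial : k) ≠ 0 := Nat.cast_ne_zero.mpr p.1.factorial_ne_zero
    have h2 : (p.2.factorial : k) ≠ 0 := Nat.cast_ne_zero.mpr p.2.factorial_ne_zero
    have h3 : (m.factorial : k) ≠ 0 := Nat.cast_ne_zero.mpr m.factorial_ne_zero
    have h4 : (m.choose p.1 : k) * p.1.factorial * p.2.factorial = m.factorial := by
      have h5 := Nat.choose_mul_factorial_mul_factorial (n := m) (k := p.1) (by omega)
      rw [show m - p.1 = p.2 by omega] at h5
      exact_mod_cast h5
    simp only [coeff_exp, map_div₀, map_one, map_natCast]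
    field_simp
    linear_combination h4
  -- The product of the two exponentials, truncated at a sufficiently high order.
  have hprod : ∃ M ≥ K, coeff n ((convExp φ hφ * convExp ψ hψ) v) =
      ∑ p ∈ Finset.range M ×ˢ Finset.range M, c p := by
    have hφ' := hφ
    have hψ' := hψ
    choose κ hκ using hφ'
    choose κ' hκ' using hψ'
    let r := Coalgebra.Repr.arbitrary k v
    obtain ⟨M, hM⟩ : ∃ M, M = K + ∑ i ∈ r.index, (κ (r.left i) (n + 1) + κ' (r.right i) (n + 1)) :=
      ⟨_, rfl⟩
    refine ⟨M, by omega, ?_⟩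
    rw [Finset.sum_product]
    simp only [c, coeff_conv_mul _ _ v n r, Finset.smul_sum]
    simp only [Finset.sum_comm (s := Finset.range _) (t := r.index)]
    refine Finset.sum_congr rfl fun a ha => ?_
    simp only [Finset.sum_comm (s := Finset.range _) (t := Finset.HasAntidiagonal.antidiagonal n)]
    refine Finset.sum_congr rfl fun q hq => ?_
    have h1 := Finset.single_le_sum (f := fun i => κ (r.left i) (n + 1) + κ' (r.right i) (n + 1))
      (fun _ _ => Nat.zero_le _) ha
    rw [Finset.HasAntidiagonal.mem_antidiagonal] at hq
    rw [convExp, convExp, coeff_evalSeries_eq_sum _ hφ _ _ M fun m hm =>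
        hκ (r.left a) (n + 1) m (by omega) _ (by omega),
      coeff_evalSeries_eq_sum _ hψ _ _ M fun m hm =>
        hκ' (r.right a) (n + 1) m (by omega) _ (by omega),
      Finset.sum_mul_sum]
    refine Finset.sum_congr rfl fun i _ => Finset.sum_congr rfl fun j _ => ?_
    rw [smul_mul_smul_comm]
    simp only [coeff_exp, one_div, map_inv₀, map_natCast]
  obtain ⟨M, hM, h⟩ := hprod
  obtain ⟨L, hL⟩ := hs v (n + 1)
  rw [h, convExp, coeff_evalSeries_eq_sum _ hs v n (L + 2 * M)
    fun m hm => hL m (by omega) n (by omega),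
    ← Finset.sum_fiberwise_of_maps_to (g := fun p : ℕ × ℕ => p.1 + p.2)
      (t := Finset.range (L + 2 * M))]
  · refine Finset.sum_congr rfl fun m _ => ?_
    rw [hpow]
    symm
    refine Finset.sum_subset (fun p hp => ?_) fun p hp hp' => ?_
    · exact Finset.HasAntidiagonal.mem_antidiagonal.mpr (Finset.mem_filter.mp hp).2
    · rw [Finset.HasAntidiagonal.mem_antidiagonal] at hp
      rw [Finset.mem_filter, Finset.mem_product, Finset.mem_range, Finset.mem_range] at hp'
      have h1 : K ≤ p.1 ∨ K ≤ p.2 := by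
        by_contra hcon
        exact hp' ⟨⟨by omega, by omega⟩, hp⟩
      simp only [c, hK p.1 p.2 h1, smul_zero]
  · intro p hp
    rw [Finset.mem_product, Finset.mem_range, Finset.mem_range] at hp
    rw [Finset.mem_range]
    omega

end EvalSeries

end MVAlgebra

/-! ### Convolution on the graded symmetric coalgebra -/

namespace GrSym

variable {k : Type u} [Field k] {U : ℤ → Type v} [∀ i, AddCommGroup (U i)] [∀ i, Module k (U i)]
  {T : Type w} [Ring T] [Algebra k T]

theorem counit_one : Coalgebra.counit (R := k) (1 : GrSym k U) = 1 := map_one (counitAlgHom k U)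

variable (k) in
/-- Left multiplication by a homogeneous generator: a coderivation of the coalgebra `S(U)`. -/
def mulGen (i : ℤ) (x : U i) : GrSym k U →ₗ[k] GrSym k U := LinearMap.mulLeft k (ι U i x)

theorem mulGen_apply (i : ℤ) (x : U i) (s : GrSym k U) : mulGen k i x s = ι U i x * s := rfl

/-- The comultiplication distributes the letters of a word over the two tensor factors. -/
theorem comulₗ_word_mem {α : Type x} (f : α → Σ i, U i) (l : List α) :
    comulₗ k U (word (l.map f)) ∈ Submodule.span k {t | ∃ l₁ l₂ : List α, (l₁ ++ l₂).Perm l ∧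
      t = word (l₁.map f) ⊗ₜ[k] word (l₂.map f)} := by
  induction l with
  | nil =>
    rw [List.map_nil, word_nil, comulₗ_one]
    exact Submodule.subset_span ⟨[], [], by simp, by simp [word_nil]⟩
  | cons a l ih =>
    rw [List.map_cons, comulₗ_word_cons]
    generalize comulₗ k U (word (l.map f)) = t at ih
    induction ih using Submodule.span_induction with
    | zero => rw [map_zero]; exact zero_mem _
    | add a b _ _ ha hb => rw [map_add]; exact add_mem ha hb
    | smul c a _ ha => rw [map_smul]; exact Submodule.smul_mem _ _ ha
    | mem t ht =>
      obtain ⟨l₁, l₂, hl, rfl⟩ := ht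
      rw [stepOp_tmul, par_word, ← TensorProduct.smul_tmul']
      refine add_mem (Submodule.subset_span ⟨a :: l₁, l₂, hl.cons a, ?_⟩)
        (Submodule.smul_mem _ _ (Submodule.subset_span ⟨l₁, a :: l₂, ?_, ?_⟩))
      · rw [List.map_cons, word_cons]
      · exact List.perm_middle.trans (hl.cons a)
      · rw [List.map_cons, word_cons]

/-- A linear functional of the comultiplication of a word vanishes if it vanishes on all the
distributions of the letters of that word over the two factors. -/
theorem map_comulₗ_word_eq_zero {α : Type x} (f : α → Σ i, U i) (l : List α) {M : Type*}
    [AddCommGroup M] [Module k M] (F : GrSym k U ⊗[k] GrSym k U →ₗ[k] M)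
    (h : ∀ l₁ l₂ : List α, (l₁ ++ l₂).Perm l → F (word (l₁.map f) ⊗ₜ word (l₂.map f)) = 0) :
    F (comulₗ k U (word (l.map f))) = 0 := by
  have h1 := comulₗ_word_mem (k := k) f l
  have h2 : Submodule.span k {t | ∃ l₁ l₂ : List α, (l₁ ++ l₂).Perm l ∧
      t = word (l₁.map f) ⊗ₜ[k] word (l₂.map f)} ≤ LinearMap.ker F := by
    rw [Submodule.span_le]
    rintro _ ⟨l₁, l₂, hl, rfl⟩
    exact h l₁ l₂ hl
  exact h2 h1

/-- A convolution product vanishes on a word, at order `n`, if it does so for each distribution of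
the letters over the two factors.  The letters are indexed by `f : α → Σ i, U i` so that words in
generators of a special form can be treated. -/
theorem coeff_conv_mul_word {α : Type x} (f : α → Σ i, U i) (l : List α)
    (φ ψ : WithConv (GrSym k U →ₗ[k] T⟦X⟧)) (n : ℕ)
    (h : ∀ l₁ l₂ : List α, (l₁ ++ l₂).Perm l →
      coeff n (φ (word (l₁.map f)) * ψ (word (l₂.map f))) = 0) :
    coeff n ((φ * ψ) (word (l.map f))) = 0 :=
  map_comulₗ_word_eq_zero f l
    ((coeff n).restrictScalars k ∘ₗ LinearMap.mul' k T⟦X⟧ ∘ₗ TensorProduct.map φ.ofConv ψ.ofConv) h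

/-- Left multiplication by a generator satisfies a signed Leibniz rule for the convolution. -/
theorem precomp_mulGen_mul (φ ψ : WithConv (GrSym k U →ₗ[k] T⟦X⟧)) (i : ℤ) (x : U i) :
    precomp (φ * ψ) (mulGen k i x) = precomp φ (mulGen k i x) * ψ +
      precomp φ (par k U i).toLinearMap * precomp ψ (mulGen k i x) := by
  ext1
  refine LinearMap.ext fun s => ?_
  change (φ * ψ) (mulGen k i x s) = (precomp φ (mulGen k i x) * ψ) s +
      (precomp φ (par k U i).toLinearMap * precomp ψ (mulGen k i x)) s
  rw [LinearMap.convMul_apply, LinearMap.convMul_apply, LinearMap.convMul_apply, comul_def,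
    comul_def, mulGen_apply, comulₗ_ι_mul]
  induction comulₗ k U s with
  | zero => simp
  | add a b ha hb => simp only [map_add, ha, hb]; abel
  | tmul a b => rw [stepOp_tmul, map_add, map_add]; rfl

theorem precomp_par_mul (φ ψ : WithConv (GrSym k U →ₗ[k] T⟦X⟧)) (i : ℤ) :
    precomp (φ * ψ) (par k U i).toLinearMap =
      precomp φ (par k U i).toLinearMap * precomp ψ (par k U i).toLinearMap := by
  ext1
  refine LinearMap.ext fun s => ?_
  change (φ * ψ) (par k U i s) =
      (precomp φ (par k U i).toLinearMap * precomp ψ (par k U i).toLinearMap) s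
  rw [LinearMap.convMul_apply, LinearMap.convMul_apply, comul_def, comul_def, comulₗ_par]
  induction comulₗ k U s with
  | zero => simp
  | add a b ha hb => simp only [map_add, ha, hb]
  | tmul a b => rfl

theorem precomp_par_one (i : ℤ) :
    precomp (1 : WithConv (GrSym k U →ₗ[k] T⟦X⟧)) (par k U i).toLinearMap = 1 := by
  ext1
  refine LinearMap.ext fun s => ?_
  change (1 : WithConv (GrSym k U →ₗ[k] T⟦X⟧)) (par k U i s) = _
  rw [LinearMap.convOne_apply, LinearMap.convOne_apply, counit_def, counit_def, counit_par]

theorem precomp_par_pow (φ : WithConv (GrSym k U →ₗ[k] T⟦X⟧)) (i : ℤ) (m : ℕ) :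
    precomp (φ ^ m) (par k U i).toLinearMap = precomp φ (par k U i).toLinearMap ^ m := by
  induction m with
  | zero => rw [pow_zero, pow_zero, precomp_par_one]
  | succ m ih => rw [pow_succ, pow_succ, precomp_par_mul, ih]

theorem precomp_mulGen_one (i : ℤ) (x : U i) :
    precomp (1 : WithConv (GrSym k U →ₗ[k] T⟦X⟧)) (mulGen k i x) = 0 := by
  ext1
  refine LinearMap.ext fun s => ?_
  change (1 : WithConv (GrSym k U →ₗ[k] T⟦X⟧)) (mulGen k i x s) = 0
  rw [LinearMap.convOne_apply, counit_def, mulGen_apply, map_mul, counitAlgHom_ι, zero_mul,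
    map_zero]

theorem mem_iSup_deg (s : GrSym k U) : s ∈ ⨆ d, deg k U d := by
  rw [(DirectSum.Decomposition.isInternal (deg k U)).submodule_iSup_eq_top]
  trivial

/-- Two maps `η` of degree `d` and `ψ` of degree zero, with values in a not necessarily graded
algebra, whose values commute up to the Koszul sign. -/
def KoszulCommute (d : ℤ) (η ψ : WithConv (GrSym k U →ₗ[k] T⟦X⟧)) : Prop :=
  ∀ i j : ℤ, ∀ a ∈ deg k U i, ∀ b ∈ deg k U j, η b * ψ a = ksign k ((j + d) * i) • (ψ a * η b)

/-- Graded cocommutativity of `S(U)` turns Koszul commutation of values into commutation in the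
convolution algebra, up to a parity twist. -/
theorem KoszulCommute.semiconjBy {d : ℤ} {η ψ : WithConv (GrSym k U →ₗ[k] T⟦X⟧)}
    (h : KoszulCommute d η ψ) :
    SemiconjBy η ψ (precomp ψ (par k U d).toLinearMap) := by
  have key : ∀ t : GrSym k U ⊗[k] GrSym k U,
      LinearMap.mul' k T⟦X⟧ (TensorProduct.map (precomp ψ (par k U d).toLinearMap).ofConv η.ofConv
        ((GradedTensorProduct.of k (deg k U) (deg k U)).symm (GradedTensorProduct.comm _ _
          (GradedTensorProduct.of k (deg k U) (deg k U) t)))) =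
      LinearMap.mul' k T⟦X⟧ (TensorProduct.map η.ofConv ψ.ofConv t) := by
    intro t
    induction t with
    | zero => simp
    | add a b ha hb => simp only [map_add, ha, hb]
    | tmul b a =>
      induction mem_iSup_deg b using Submodule.iSup_induction' with
      | zero => simp
      | add b b' _ _ h h' => simp only [TensorProduct.add_tmul, map_add, h, h']
      | mem j b hb =>
        induction mem_iSup_deg a using Submodule.iSup_induction' with
        | zero => simp
        | add a a' _ _ h h' => simp only [TensorProduct.tmul_add, map_add, h, h']
        | mem i a ha =>
          have h1 := GradedTensorProduct.comm_coe_tmul_coe (R := k) (deg k U) (deg k U)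
            ⟨b, hb⟩ ⟨a, ha⟩
          rw [units_smul_eq (k := k)] at h1
          refine (congrArg (fun z => LinearMap.mul' k T⟦X⟧ (TensorProduct.map
            (precomp ψ (par k U d).toLinearMap).ofConv η.ofConv
            ((GradedTensorProduct.of k (deg k U) (deg k U)).symm z))) h1).trans ?_
          simp only [map_smul]
          change ksign k (i * j) • (ψ (par k U d a) * η b) = η b * ψ a
          rw [h i j a ha b hb, par_of_mem d i a ha, map_smul, smul_mul_assoc, smul_smul,
            ← ksign_add]
          congr 2
          ring
  rw [SemiconjBy]
  ext1
  refine LinearMap.ext fun s => ?_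
  rw [LinearMap.convMul_apply, LinearMap.convMul_apply, ← key]
  congr 2
  exact (congrArg _ (cocomm s)).trans rfl

/-- The chain rule for convolution powers.  The hypothesis moves all the factors `φ`, whatever
their position, behind the one which is differentiated. -/
theorem precomp_mulGen_pow {φ : WithConv (GrSym k U →ₗ[k] T⟦X⟧)} {i : ℤ} {x : U i}
    (h : KoszulCommute i (precomp φ (mulGen k i x)) φ) (m : ℕ) :
    precomp (φ ^ (m + 1)) (mulGen k i x) =
      ((m : k) + 1) • (precomp φ (mulGen k i x) * φ ^ m) := by
  induction m with
  | zero => rw [zero_add, pow_one, pow_zero, mul_one, Nat.cast_zero, zero_add, one_smul]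
  | succ m ih =>
    rw [pow_succ, precomp_mulGen_mul, ih, precomp_par_pow,
      ← (h.semiconjBy.pow_right (m + 1)).eq, smul_mul_assoc, mul_assoc, ← pow_succ,
      Nat.cast_succ]
    module

variable [CharZero k]

/-- The chain rule for the convolution exponential. -/
theorem precomp_mulGen_convExp {φ : WithConv (GrSym k U →ₗ[k] T⟦X⟧)} (hφ : TopNilp φ) {i : ℤ}
    {x : U i} (h : KoszulCommute i (precomp φ (mulGen k i x)) φ) :
    precomp (convExp φ hφ) (mulGen k i x) = precomp φ (mulGen k i x) * convExp φ hφ := by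
  ext1
  refine LinearMap.ext fun s => PowerSeries.ext fun n => ?_
  obtain ⟨M, hM⟩ := coeff_mul_evalSeries (PowerSeries.exp k) hφ (precomp φ (mulGen k i x)) s n
  obtain ⟨K, hK⟩ := hφ (mulGen k i x s) (n + 1)
  rw [convExp, hM (M + K) (by omega)]
  change coeff n (evalSeries _ φ hφ (mulGen k i x s)) = _
  rw [coeff_evalSeries_eq_sum _ hφ _ n (M + K + 1) fun m hm => hK m (by omega) n (by omega),
    Finset.sum_range_succ', pow_zero]
  have h0 : (1 : WithConv (GrSym k U →ₗ[k] T⟦X⟧)) (mulGen k i x s) = 0 :=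
    congrArg (fun ψ : WithConv (GrSym k U →ₗ[k] T⟦X⟧) => ψ s) (precomp_mulGen_one i x)
  rw [h0, map_zero, smul_zero, add_zero]
  refine Finset.sum_congr rfl fun m _ => ?_
  have h1 : (φ ^ (m + 1)) (mulGen k i x s) =
      ((m : k) + 1) • (precomp φ (mulGen k i x) * φ ^ m) s :=
    congrArg (fun ψ : WithConv (GrSym k U →ₗ[k] T⟦X⟧) => ψ s) (precomp_mulGen_pow h m)
  rw [h1, PowerSeries.coeff_smul, smul_smul]
  congr 1
  have h2 : (m : k) + 1 ≠ 0 := Nat.cast_add_one_ne_zero m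
  have h3 : (m.factorial : k) ≠ 0 := Nat.cast_ne_zero.mpr m.factorial_ne_zero
  simp only [coeff_exp, Nat.factorial_succ, Nat.cast_mul, map_div₀, map_one, map_mul, map_natCast,
    Nat.cast_succ]
  field_simp
  rw [map_add, map_natCast, map_one]

end GrSym


/-! ### Change of target and completed coalgebra maps -/

namespace MVAlgebra

section Postcomp

variable {k : Type u} [Field k] {T : Type w} [Ring T] [Algebra k T] {T' : Type x} [Ring T']
  [Algebra k T']

/-- The linear map `T⟦X⟧ → T'⟦X⟧` acting on the coefficients by a linear map. -/
def mapCoeff (σ : T →ₗ[k] T') : T⟦X⟧ →ₗ[k] T'⟦X⟧ where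
  toFun s := PowerSeries.mk fun n => σ (coeff n s)
  map_add' a b := by ext n; simp
  map_smul' c a := by ext n; simp

theorem coeff_mapCoeff (σ : T →ₗ[k] T') (s : T⟦X⟧) (n : ℕ) :
    coeff n (mapCoeff σ s) = σ (coeff n s) :=
  coeff_mk n fun n => σ (coeff n s)

theorem mapCoeff_mul (ρ : T →ₐ[k] T') (s t : T⟦X⟧) :
    mapCoeff ρ.toLinearMap (s * t) = mapCoeff ρ.toLinearMap s * mapCoeff ρ.toLinearMap t := by
  ext n
  simp only [coeff_mapCoeff, coeff_mul, map_sum, AlgHom.toLinearMap_apply, map_mul]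

variable {V : Type v} [AddCommGroup V] [Module k V]

/-- Apply a linear map to the coefficients of the values of `φ`. -/
def postcomp (σ : T →ₗ[k] T') (φ : WithConv (V →ₗ[k] T⟦X⟧)) : WithConv (V →ₗ[k] T'⟦X⟧) :=
  toConv (mapCoeff σ ∘ₗ φ.ofConv)

theorem coeff_postcomp (σ : T →ₗ[k] T') (φ : WithConv (V →ₗ[k] T⟦X⟧)) (v : V) (n : ℕ) :
    coeff n (postcomp σ φ v) = σ (coeff n (φ v)) :=
  coeff_mapCoeff σ (φ v) n

variable [Coalgebra k V] (ρ : T →ₐ[k] T')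

theorem postcomp_mul (φ ψ : WithConv (V →ₗ[k] T⟦X⟧)) :
    postcomp ρ.toLinearMap (φ * ψ) = postcomp ρ.toLinearMap φ * postcomp ρ.toLinearMap ψ := by
  ext1
  refine LinearMap.ext fun v => ?_
  let r := Coalgebra.Repr.arbitrary k v
  change mapCoeff ρ.toLinearMap ((φ * ψ) v) = _
  rw [r.convMul_apply, r.convMul_apply, map_sum]
  exact Finset.sum_congr rfl fun i _ => mapCoeff_mul ρ _ _

theorem postcomp_one :
    postcomp ρ.toLinearMap (1 : WithConv (V →ₗ[k] T⟦X⟧)) = 1 := by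
  ext v n
  rw [coeff_postcomp, LinearMap.convOne_apply, LinearMap.convOne_apply,
    PowerSeries.algebraMap_apply, PowerSeries.algebraMap_apply, coeff_C, coeff_C]
  split_ifs
  · exact ρ.commutes _
  · exact map_zero _

theorem postcomp_pow (φ : WithConv (V →ₗ[k] T⟦X⟧)) (m : ℕ) :
    postcomp ρ.toLinearMap (φ ^ m) = postcomp ρ.toLinearMap φ ^ m := by
  induction m with
  | zero => rw [pow_zero, pow_zero, postcomp_one]
  | succ m ih => rw [pow_succ, pow_succ, postcomp_mul, ih]

end Postcomp

section PostcompExp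

variable {k : Type u} [Field k] {V : Type v} [Ring V] [Algebra k V] [Coalgebra k V]
  {T : Type w} [Ring T] [Algebra k T] {T' : Type x} [Ring T'] [Algebra k T'] (ρ : T →ₐ[k] T')

theorem TopNilp.postcomp {φ : WithConv (V →ₗ[k] T⟦X⟧)} (h : TopNilp φ) :
    TopNilp (postcomp ρ.toLinearMap φ) := by
  intro v N
  obtain ⟨K, hK⟩ := h v N
  exact ⟨K, fun m hm n hn => by rw [← postcomp_pow, coeff_postcomp, hK m hm n hn, map_zero]⟩

theorem postcomp_convExp [CharZero k] {φ : WithConv (V →ₗ[k] T⟦X⟧)} (h : TopNilp φ) :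
    MVAlgebra.postcomp ρ.toLinearMap (convExp φ h) =
      convExp (MVAlgebra.postcomp ρ.toLinearMap φ) (h.postcomp ρ) := by
  ext v n
  obtain ⟨K, hK⟩ := h v (n + 1)
  have hK' : ∀ m ≥ K, coeff n ((φ ^ m) v) = 0 := fun m hm => hK m hm n (by omega)
  rw [coeff_postcomp, convExp, convExp, coeff_evalSeries_eq_sum _ h v n K hK',
    coeff_evalSeries_eq_sum _ _ v n K fun m hm => by
      rw [← postcomp_pow, coeff_postcomp, hK' m hm, map_zero], map_sum]
  exact Finset.sum_congr rfl fun m _ => by rw [map_smul, ← postcomp_pow, coeff_postcomp]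

theorem convExp_congr [CharZero k] {φ ψ : WithConv (V →ₗ[k] T⟦X⟧)} (e : φ = ψ) (h : TopNilp φ)
    (h' : TopNilp ψ) : convExp φ h = convExp ψ h' :=
  evalSeries_congr _ e h h'

theorem convExp_eq_one [CharZero k] {φ : WithConv (V →ₗ[k] T⟦X⟧)} (h : TopNilp φ) (h0 : φ = 0) :
    convExp φ h = 1 := by
  subst h0
  ext v n
  rw [convExp, coeff_evalSeries, finsum_eq_single _ 0]
  · simp
  · intro m hm
    rw [zero_pow hm]
    simp

end PostcompExp

section CompHat

variable {k : Type u} [Field k] {C : Type v} [Ring C] [Algebra k C]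
  {D : Type w} [Ring D] [Algebra k D] {T : Type x} [Ring T] [Algebra k T]

/-- The composite of `θ : D → C⟦X⟧` with the `k⟦X⟧`-linear extension of `φ : C → T⟦X⟧`. -/
def compHat (φ : WithConv (C →ₗ[k] T⟦X⟧)) (θ : WithConv (D →ₗ[k] C⟦X⟧)) :
    WithConv (D →ₗ[k] T⟦X⟧) :=
  toConv (restr (extend φ.ofConv ∘ₗ extend θ.ofConv))

theorem compHat_apply (φ : WithConv (C →ₗ[k] T⟦X⟧)) (θ : WithConv (D →ₗ[k] C⟦X⟧)) (v : D) :
    compHat φ θ v = extend φ.ofConv (θ v) :=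
  congrArg (extend φ.ofConv) (LinearMap.congr_fun (restr_extend θ.ofConv) v)

theorem coeff_compHat (φ : WithConv (C →ₗ[k] T⟦X⟧)) (θ : WithConv (D →ₗ[k] C⟦X⟧)) (v : D)
    (n : ℕ) : coeff n (compHat φ θ v) =
      ∑ q ∈ Finset.HasAntidiagonal.antidiagonal n, coeff q.1 (φ (coeff q.2 (θ v))) := by
  rw [compHat_apply, coeff_extend]

/-- The `n`-th coefficient of a series-valued linear map. -/
def coeffMap (θ : WithConv (D →ₗ[k] C⟦X⟧)) (n : ℕ) : D →ₗ[k] C :=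
  (coeff n).restrictScalars k ∘ₗ θ.ofConv

theorem coeffMap_apply (θ : WithConv (D →ₗ[k] C⟦X⟧)) (n : ℕ) (v : D) :
    coeffMap θ n v = coeff n (θ v) := rfl

/-- Two ways of summing over the quadruples of total `n`. -/
theorem sum_antidiagonal_four {M : Type*} [AddCommMonoid M] (F : ℕ → ℕ → ℕ → ℕ → M) (n : ℕ) :
    ∑ q ∈ Finset.HasAntidiagonal.antidiagonal n, ∑ s ∈ Finset.HasAntidiagonal.antidiagonal q.2,
      ∑ t ∈ Finset.HasAntidiagonal.antidiagonal q.1, F t.1 s.1 t.2 s.2 =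
    ∑ q ∈ Finset.HasAntidiagonal.antidiagonal n, ∑ s ∈ Finset.HasAntidiagonal.antidiagonal q.1,
      ∑ t ∈ Finset.HasAntidiagonal.antidiagonal q.2, F s.1 s.2 t.1 t.2 := by
  simp only [← Finset.sum_product']
  rw [Finset.sum_sigma', Finset.sum_sigma']
  refine Finset.sum_bij'
    (fun z _ => ⟨(z.2.2.1 + z.2.1.1, z.2.2.2 + z.2.1.2), ((z.2.2.1, z.2.1.1), (z.2.2.2, z.2.1.2))⟩)
    (fun z _ => ⟨(z.2.1.1 + z.2.2.1, z.2.1.2 + z.2.2.2), ((z.2.1.2, z.2.2.2), (z.2.1.1, z.2.2.1))⟩)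
    ?_ ?_ ?_ ?_ ?_ <;>
  rintro ⟨⟨a, b⟩, ⟨c, d⟩, ⟨e, f⟩⟩ h <;>
  simp only [Finset.mem_sigma, Finset.mem_product, Finset.HasAntidiagonal.mem_antidiagonal,
    and_self, and_true] at h ⊢
  · omega
  · omega
  · obtain ⟨h1, rfl, rfl⟩ := h; rfl
  · obtain ⟨h1, rfl, rfl⟩ := h; rfl

variable [Coalgebra k D]

/-- The product of two maps `D → T⟦X⟧` obtained from the same `θ : D → C⟦X⟧`. -/
theorem coeff_postcomp_mul_postcomp (ρ₁ ρ₂ : C →ₐ[k] T) (m : C ⊗[k] C →+ T)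
    (hm : ∀ a b, ρ₁ a * ρ₂ b = m (a ⊗ₜ b)) (θ : WithConv (D →ₗ[k] C⟦X⟧)) (v : D) (n : ℕ) :
    coeff n ((postcomp ρ₁.toLinearMap θ * postcomp ρ₂.toLinearMap θ) v) =
      m (∑ q ∈ Finset.HasAntidiagonal.antidiagonal n,
        TensorProduct.map (coeffMap θ q.1) (coeffMap θ q.2) (Coalgebra.comul v)) := by
  rw [LinearMap.convMul_apply]
  induction (Coalgebra.comul v : D ⊗[k] D) with
  | zero => simp
  | add a b ha hb => simp only [map_add, Finset.sum_add_distrib, ha, hb]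
  | tmul a b =>
    rw [TensorProduct.map_tmul, LinearMap.mul'_apply, coeff_mul, map_sum]
    refine Finset.sum_congr rfl fun q _ => ?_
    rw [coeff_postcomp, coeff_postcomp]
    exact hm _ _

variable [Coalgebra k C]

/-- `θ : D → C⟦X⟧` induces a map of coalgebras `D⟦X⟧ → C⟦X⟧` in the completed sense: `δ ∘ θ` and
`(θ ⊗ θ) ∘ δ` agree as series with coefficients in `C ⊗ C`, and `ε ∘ θ = ε`. -/
structure IsCompletedCoalgHom (θ : WithConv (D →ₗ[k] C⟦X⟧)) : Prop where
  counit : ∀ v n, Coalgebra.counit (R := k) (coeff n (θ v)) =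
    if n = 0 then Coalgebra.counit (R := k) v else 0
  comul : ∀ v n, (Coalgebra.comul (coeff n (θ v)) : C ⊗[k] C) =
    ∑ q ∈ Finset.HasAntidiagonal.antidiagonal n,
      TensorProduct.map (coeffMap θ q.1) (coeffMap θ q.2) (Coalgebra.comul v)

variable {θ : WithConv (D →ₗ[k] C⟦X⟧)}

theorem IsCompletedCoalgHom.compHat_one (hθ : IsCompletedCoalgHom θ) :
    compHat (1 : WithConv (C →ₗ[k] T⟦X⟧)) θ = 1 := by
  ext v n
  rw [coeff_compHat, Finset.sum_eq_single (n, 0)]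
  · simp only [LinearMap.convOne_apply, hθ.counit, if_pos]
  · rintro ⟨a, b⟩ h hne
    have hb : b ≠ 0 := by
      rintro rfl
      exact hne (by simpa using h)
    simp only [LinearMap.convOne_apply, hθ.counit, if_neg hb, map_zero]
  · simp

theorem IsCompletedCoalgHom.compHat_mul (hθ : IsCompletedCoalgHom θ)
    (φ ψ : WithConv (C →ₗ[k] T⟦X⟧)) :
    compHat (φ * ψ) θ = compHat φ θ * compHat ψ θ := by
  ext v n
  rw [coeff_compHat]
  simp only [LinearMap.convMul_apply, hθ.comul, map_sum]
  induction (Coalgebra.comul v : D ⊗[k] D) with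
  | zero => simp
  | add a b ha hb => simp only [map_add, Finset.sum_add_distrib, ha, hb]
  | tmul a b =>
    simp only [TensorProduct.map_tmul, LinearMap.mul'_apply, coeff_mul, coeff_compHat,
      coeffMap_apply, Finset.sum_mul_sum]
    exact sum_antidiagonal_four
      (fun i p j q => coeff i (φ (coeff p (θ a))) * coeff j (ψ (coeff q (θ b)))) n

theorem IsCompletedCoalgHom.compHat_pow (hθ : IsCompletedCoalgHom θ)
    (φ : WithConv (C →ₗ[k] T⟦X⟧)) (m : ℕ) :
    compHat (φ ^ m) θ = compHat φ θ ^ m := by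
  induction m with
  | zero => rw [pow_zero, pow_zero, hθ.compHat_one]
  | succ m ih => rw [pow_succ, pow_succ, hθ.compHat_mul, ih]

theorem IsCompletedCoalgHom.topNilp (hθ : IsCompletedCoalgHom θ)
    {φ : WithConv (C →ₗ[k] T⟦X⟧)} (h : TopNilp φ) :
    TopNilp (compHat φ θ) := by
  intro v N
  choose κ hκ using h
  refine ⟨∑ j ∈ Finset.range N, κ (coeff j (θ v)) N, fun m hm n hn => ?_⟩
  rw [← hθ.compHat_pow, coeff_compHat]
  refine Finset.sum_eq_zero fun q hq => ?_
  rw [Finset.HasAntidiagonal.mem_antidiagonal] at hq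
  exact hκ _ N m ((Finset.single_le_sum (f := fun j => κ (coeff j (θ v)) N)
    (fun _ _ => Nat.zero_le _) (Finset.mem_range.mpr (by omega))).trans hm) _ (by omega)

/-- Completed coalgebra maps are compatible with the convolution exponential. -/
theorem IsCompletedCoalgHom.compHat_convExp [CharZero k] (hθ : IsCompletedCoalgHom θ)
    {φ : WithConv (C →ₗ[k] T⟦X⟧)}
    (h : TopNilp φ) :
    compHat (convExp φ h) θ = convExp (compHat φ θ) (hθ.topNilp h) := by
  ext v n
  have h' := h
  choose κ hκ using h'
  obtain ⟨K, hK⟩ := hθ.topNilp h v (n + 1)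
  rw [coeff_compHat, convExp, convExp, coeff_evalSeries_eq_sum _ _ v n
    (K + ∑ j ∈ Finset.range (n + 1), κ (coeff j (θ v)) (n + 1))
    fun m hm => hK m (by omega) n (by omega)]
  simp only [← hθ.compHat_pow, coeff_compHat, Finset.smul_sum]
  rw [Finset.sum_comm]
  refine Finset.sum_congr rfl fun q hq => ?_
  rw [Finset.HasAntidiagonal.mem_antidiagonal] at hq
  have h1 := Finset.single_le_sum (f := fun j => κ (coeff j (θ v)) (n + 1))
    (fun _ _ => Nat.zero_le _) (Finset.mem_range.mpr (by omega : q.2 < n + 1))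
  exact coeff_evalSeries_eq_sum _ h _ _ _ fun m hm => hκ _ (n + 1) m (by omega) _ (by omega)

end CompHat

end MVAlgebra


/-! ### The symmetric algebra on the graded space underlying `S(W)` -/

namespace GrSym

variable {k : Type u} [Field k]

variable (k) in
/-- `S(U)` as an MV-algebra with zero structure operator.  It serves to apply statements about
MV-algebras which do not involve the structure operator. -/
def mv (U : ℤ → Type v) [∀ i, AddCommGroup (U i)] [∀ i, Module k (U i)] :
    MVAlg.{u, max u v} k where
  V := GrSym k U
  deg := deg k U
  mul_comm := mul_comm_deg
  comul_mem := comulₗ_mem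
  counit_deg := counit_deg
  cocomm := cocomm
  comul_one := comulₗ_one
  counit_one := map_one (counitAlgHom k U)
  counit_mul := map_mul (counitAlgHom k U)
  conilpotent := conilpotent
  Δ := 0
  Δ_deg _ _ _ _ := by
    rw [LinearMap.zero_apply, map_zero]
    exact zero_mem _
  Δ_sq := LinearMap.zero_comp _
  Δ_one := LinearMap.zero_apply _

variable {W : ℤ → Type v} [∀ i, AddCommGroup (W i)] [∀ i, Module k (W i)]

variable (k W) in
/-- The graded vector space underlying `S(W)`. -/
abbrev Pieces (d : ℤ) : Type (max u v) := deg k W d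

variable (k W) in
/-- The inclusion of `S(W)` into `S(S(W))` as the space of generators. -/
def emb : GrSym k W →ₗ[k] GrSym k (Pieces k W) :=
  DirectSum.toModule k ℤ _ (fun d => ι (k := k) (Pieces k W) d) ∘ₗ
    (DirectSum.decomposeLinearEquiv (deg k W)).toLinearMap

theorem emb_of_mem {d : ℤ} {a : GrSym k W} (ha : a ∈ deg k W d) :
    emb k W a = ι (Pieces k W) d ⟨a, ha⟩ := by
  have h := DirectSum.decomposeLinearEquiv_apply_coe (R := k) (deg k W) d ⟨a, ha⟩
  refine (congrArg (DirectSum.toModule k ℤ _ (fun d => ι (k := k) (Pieces k W) d)) h).trans ?_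
  rw [DirectSum.toModule_lof]

theorem emb_mem {d : ℤ} {a : GrSym k W} (ha : a ∈ deg k W d) :
    emb k W a ∈ deg k (Pieces k W) d := by
  rw [emb_of_mem ha]
  exact ι_mem_deg _ _

theorem emb_mem_symPow (a : GrSym k W) : emb k W a ∈ symPow k (Pieces k W) 1 := by
  induction mem_iSup_deg a using Submodule.iSup_induction' with
  | zero => rw [map_zero]; exact zero_mem _
  | add a b _ _ ha hb => rw [map_add]; exact add_mem ha hb
  | mem d a ha =>
    rw [emb_of_mem ha, ← word_single]
    exact Submodule.subset_span ⟨_, rfl, rfl⟩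

theorem counit_emb (a : GrSym k W) : counitAlgHom k (Pieces k W) (emb k W a) = 0 := by
  induction mem_iSup_deg a using Submodule.iSup_induction' with
  | zero => rw [map_zero, map_zero]
  | add a b _ _ ha hb => rw [map_add, map_add, ha, hb, add_zero]
  | mem d a ha => rw [emb_of_mem ha, counitAlgHom_ι]

variable (k W) in
/-- The left inclusion of `S(W)` into its graded tensor square. -/
def incl₁ : GrSym k W →ₐ[k] GradedTensorProduct k (deg k W) (deg k W) :=
  GradedTensorProduct.includeLeft (deg k W) (deg k W)

variable (k W) in
/-- The right inclusion of `S(W)` into its graded tensor square. -/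
def incl₂ : GrSym k W →ₐ[k] GradedTensorProduct k (deg k W) (deg k W) :=
  GradedTensorProduct.includeRight (deg k W) (deg k W)

theorem incl₁_mul_incl₂ (a b : GrSym k W) : incl₁ k W a * incl₂ k W b =
    GradedTensorProduct.of k (deg k W) (deg k W) (a ⊗ₜ b) :=
  GradedTensorProduct.tmul_one_mul_one_tmul (R := k) (deg k W) (deg k W) a b

theorem incl₂_mul_incl₁ {i j : ℤ} {a b : GrSym k W} (ha : a ∈ deg k W i) (hb : b ∈ deg k W j) :
    incl₂ k W b * incl₁ k W a = ksign k (j * i) • (incl₁ k W a * incl₂ k W b) := by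
  have h := GradedTensorProduct.tmul_coe_mul_coe_tmul (R := k) (deg k W) (deg k W)
    1 ⟨b, hb⟩ ⟨a, ha⟩ 1
  rw [units_smul_eq (k := k), one_mul, mul_one] at h
  rw [incl₁_mul_incl₂]
  exact h

theorem comulAlgHom_emb (a : GrSym k W) : comulAlgHom (emb k W a) =
    incl₁ k (Pieces k W) (emb k W a) + incl₂ k (Pieces k W) (emb k W a) := by
  induction mem_iSup_deg a using Submodule.iSup_induction' with
  | zero => simp only [map_zero, add_zero]
  | add a b _ _ ha hb => simp only [map_add, ha, hb]; abel
  | mem d a ha => rw [emb_of_mem ha, comulAlgHom_ι]; rfl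

variable (k W) in
/-- The multiplication `S(S(W)) → S(W)`: the algebra map extending the identity of `S(W)`. -/
def muHat : GrSym k (Pieces k W) →ₐ[k] GrSym k W :=
  lift (U := Pieces k W) (fun d => (deg k W d).subtype) fun i j x y =>
    mul_comm_deg i j x.1 x.2 y.1 y.2

theorem muHat_emb (a : GrSym k W) : muHat k W (emb k W a) = a := by
  induction mem_iSup_deg a using Submodule.iSup_induction' with
  | zero => rw [map_zero, map_zero]
  | add a b _ _ ha hb => rw [map_add, map_add, ha, hb]
  | mem d a ha => rw [emb_of_mem ha]; exact lift_ι (U := Pieces k W) _ _ d ⟨a, ha⟩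

theorem muHat_mem {d : ℤ} {s : GrSym k (Pieces k W)} (hs : s ∈ deg k (Pieces k W) d) :
    muHat k W s ∈ deg k W d := by
  rw [deg] at hs
  induction hs using Submodule.span_induction with
  | zero => rw [map_zero]; exact zero_mem _
  | add a b _ _ ha hb => rw [map_add]; exact add_mem ha hb
  | smul c a _ ha => rw [map_smul]; exact Submodule.smul_mem _ _ ha
  | mem s hs =>
    obtain ⟨l, rfl, rfl⟩ := hs
    induction l with
    | nil =>
      rw [word_nil, map_one]
      exact SetLike.one_mem_graded _
    | cons p l ih =>
      rw [word_cons, map_mul, wordDeg_cons]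
      refine SetLike.mul_mem_graded ?_ ih
      have h : muHat k W (ι (Pieces k W) p.1 p.2) = p.2 :=
        lift_ι (U := Pieces k W) _ _ p.1 p.2
      rw [h]
      exact p.2.2

variable (k W) in
/-- The algebra map `S(W) → S(S(W))` which is the canonical inclusion on `W`. -/
def embAlgHom : GrSym k W →ₐ[k] GrSym k (Pieces k W) :=
  lift (fun d => emb k W ∘ₗ ι W d) fun i j x y =>
    mul_comm_deg i j _ (emb_mem (ι_mem_deg i x)) _ (emb_mem (ι_mem_deg j y))

theorem embAlgHom_ι (d : ℤ) (x : W d) :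
    embAlgHom k W (ι W d x) = emb k W (ι W d x) := lift_ι _ _ d x

theorem muHat_embAlgHom (s : GrSym k W) : muHat k W (embAlgHom k W s) = s := by
  have h : (muHat k W).comp (embAlgHom k W) = AlgHom.id k _ := algHom_ext' fun d x => by
    rw [AlgHom.comp_apply, embAlgHom_ι, muHat_emb, AlgHom.id_apply]
  exact DFunLike.congr_fun h s

theorem embAlgHom_par (i : ℤ) (s : GrSym k W) :
    embAlgHom k W (par k W i s) = par k (Pieces k W) i (embAlgHom k W s) := by
  have h : (embAlgHom k W).comp (par k W i) = (par k (Pieces k W) i).comp (embAlgHom k W) :=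
    algHom_ext' fun d x => by
      rw [AlgHom.comp_apply, AlgHom.comp_apply, par_ι, map_smul, embAlgHom_ι,
        par_of_mem i d _ (emb_mem (ι_mem_deg d x))]
  exact DFunLike.congr_fun h s

theorem comulₗ_embAlgHom (s : GrSym k W) : comulₗ k (Pieces k W) (embAlgHom k W s) =
    TensorProduct.map (embAlgHom k W).toLinearMap (embAlgHom k W).toLinearMap (comulₗ k W s) := by
  have h : comulₗ k (Pieces k W) ∘ₗ (embAlgHom k W).toLinearMap =
      TensorProduct.map (embAlgHom k W).toLinearMap (embAlgHom k W).toLinearMap ∘ₗ comulₗ k W := by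
    refine linearMap_ext_word fun l => ?_
    simp only [LinearMap.comp_apply, AlgHom.toLinearMap_apply]
    induction l with
    | nil =>
      simp only [word_nil, map_one, comulₗ_one, TensorProduct.map_tmul, AlgHom.toLinearMap_apply]
    | cons p l ih =>
      rw [comulₗ_word_cons, word_cons, map_mul, embAlgHom_ι, emb_of_mem (ι_mem_deg p.1 p.2),
        comulₗ_ι_mul, ih]
      induction comulₗ k W (word l) with
      | zero => simp only [map_zero]
      | add a b ha hb => simp only [map_add, ha, hb]
      | tmul a b =>
        simp only [TensorProduct.map_tmul, stepOp_tmul, map_add, AlgHom.toLinearMap_apply, map_mul,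
          embAlgHom_ι, emb_of_mem (ι_mem_deg p.1 p.2), embAlgHom_par]
  exact LinearMap.congr_fun h s

theorem counit_embAlgHom (s : GrSym k W) :
    counitAlgHom k (Pieces k W) (embAlgHom k W s) = counitAlgHom k W s := by
  have h : (counitAlgHom k (Pieces k W)).comp (embAlgHom k W) = counitAlgHom k W :=
    algHom_ext' fun d x => by rw [AlgHom.comp_apply, embAlgHom_ι, counit_emb, counitAlgHom_ι]
  exact DFunLike.congr_fun h s

section ExpEmb

variable {U : ℤ → Type v} [∀ i, AddCommGroup (U i)] [∀ i, Module k (U i)]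

theorem topNilp_of_deg {B : MVAlg.{u, max u v} k} {φ : WithConv (GrSym k U →ₗ[k] B.V⟦X⟧)}
    (hφ : ∀ d : ℤ, ∀ v ∈ deg k U d, ∀ n : ℕ, coeff n (φ v) ∈ B.deg d) (h0 : coeff 0 (φ 1) = 0) :
    TopNilp φ :=
  MVAlg.topNilp (A := mv k U) hφ h0

theorem topNilp_emb {g : WithConv (GrSym k U →ₗ[k] (GrSym k W)⟦X⟧)}
    (hg : ∀ d : ℤ, ∀ v ∈ deg k U d, ∀ n : ℕ, coeff n (g v) ∈ deg k W d)
    (h0 : coeff 0 (g 1) = 0) : TopNilp (postcomp (emb k W) g) := by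
  have h1 : ∀ d : ℤ, ∀ v ∈ deg k U d, ∀ n : ℕ,
      coeff n (postcomp (emb k W) g v) ∈ deg k (Pieces k W) d := fun d v hv n => by
    rw [coeff_postcomp]
    exact emb_mem (hg d v hv n)
  have h2 : coeff 0 (postcomp (emb k W) g 1) = 0 := by rw [coeff_postcomp, h0, map_zero]
  exact topNilp_of_deg (B := mv k (Pieces k W)) h1 h2

/-- The map `S(U) → S(S(W))⟦X⟧` cogenerated by a map `S(U) → S(W)⟦X⟧` is a map of coalgebras: its
composite with the comultiplication is the exponential of a sum of two commuting maps, with values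
in the two factors of the graded tensor square. -/
theorem isCompletedCoalgHom_convExp_emb [CharZero k]
    {g : WithConv (GrSym k U →ₗ[k] (GrSym k W)⟦X⟧)}
    (hg : ∀ d : ℤ, ∀ v ∈ deg k U d, ∀ n : ℕ, coeff n (g v) ∈ deg k W d)
    (h : TopNilp (postcomp (emb k W) g)) :
    IsCompletedCoalgHom (convExp (postcomp (emb k W) g) h) := by
  constructor
  · intro v n
    have h1 : postcomp (counitAlgHom k (Pieces k W)).toLinearMap (postcomp (emb k W) g) = 0 := by
      ext v n
      rw [coeff_postcomp, coeff_postcomp]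
      exact counit_emb _
    have h2 := postcomp_convExp (counitAlgHom k (Pieces k W)) h
    rw [convExp_eq_one _ h1] at h2
    have h3 := coeff_postcomp (counitAlgHom k (Pieces k W)).toLinearMap
      (convExp (postcomp (emb k W) g) h) v n
    rw [h2, LinearMap.convOne_apply, PowerSeries.algebraMap_apply, coeff_C] at h3
    exact h3.symm
  · intro v n
    have ha := h.postcomp (incl₁ k (Pieces k W))
    have hb := h.postcomp (incl₂ k (Pieces k W))
    have hs : postcomp comulAlgHom.toLinearMap (postcomp (emb k W) g) =
        postcomp (incl₁ k (Pieces k W)).toLinearMap (postcomp (emb k W) g) +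
        postcomp (incl₂ k (Pieces k W)).toLinearMap (postcomp (emb k W) g) := by
      ext v n
      rw [ofConv_add, LinearMap.add_apply, map_add]
      simp only [coeff_postcomp]
      exact comulAlgHom_emb _
    have hk : KoszulCommute 0
        (postcomp (incl₂ k (Pieces k W)).toLinearMap (postcomp (emb k W) g))
        (postcomp (incl₁ k (Pieces k W)).toLinearMap (postcomp (emb k W) g)) := by
      intro i j a ha b hb
      ext n
      rw [PowerSeries.coeff_smul, coeff_mul, coeff_mul, ← Finset.Nat.sum_antidiagonal_swap,
        Finset.smul_sum]
      refine Finset.sum_congr rfl fun q _ => ?_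
      simp only [coeff_postcomp, AlgHom.toLinearMap_apply, Prod.fst_swap, Prod.snd_swap, add_zero]
      exact incl₂_mul_incl₁ (emb_mem (hg i a ha _)) (emb_mem (hg j b hb _))
    have hc : Commute (postcomp (incl₁ k (Pieces k W)).toLinearMap (postcomp (emb k W) g))
        (postcomp (incl₂ k (Pieces k W)).toLinearMap (postcomp (emb k W) g)) := by
      have h1 := hk.semiconjBy.eq
      have h2 : precomp (postcomp (incl₁ k (Pieces k W)).toLinearMap (postcomp (emb k W) g))
          (par k U 0).toLinearMap =
          postcomp (incl₁ k (Pieces k W)).toLinearMap (postcomp (emb k W) g) := by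
        ext1
        refine linearMap_ext_word fun l => ?_
        change postcomp (incl₁ k (Pieces k W)).toLinearMap (postcomp (emb k W) g)
          (par k U 0 (word l)) = _
        rw [par_word, zero_mul, ksign_zero, one_smul]
      rw [h2] at h1
      exact h1.symm
    have h4 := postcomp_convExp comulAlgHom h
    have hsum : TopNilp (postcomp (incl₁ k (Pieces k W)).toLinearMap (postcomp (emb k W) g) +
        postcomp (incl₂ k (Pieces k W)).toLinearMap (postcomp (emb k W) g)) :=
      hs ▸ h.postcomp comulAlgHom
    replace h4 := h4.trans ((convExp_congr hs _ hsum).trans (convExp_add hc ha hb hsum))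
    rw [← postcomp_convExp _ h, ← postcomp_convExp _ h] at h4
    have h5 := coeff_postcomp comulAlgHom.toLinearMap (convExp (postcomp (emb k W) g) h) v n
    rw [h4] at h5
    apply (GradedTensorProduct.of k (deg k (Pieces k W)) (deg k (Pieces k W))).injective
    refine h5.symm.trans ?_
    exact coeff_postcomp_mul_postcomp _ _
      (GradedTensorProduct.of k (deg k (Pieces k W)) (deg k (Pieces k W))).toAddMonoidHom
      incl₁_mul_incl₂ _ v n

end ExpEmb

end GrSym


/-! ### Cumulants -/

namespace MVAlgebra

theorem convExp_injective {k : Type u} [Field k] [CharZero k] {V : Type v} [Ring V] [Algebra k V]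
    [Coalgebra k V] {T : Type w} [Ring T] [Algebra k T] {φ ψ : WithConv (V →ₗ[k] T⟦X⟧)}
    (hφ : TopNilp φ) (hψ : TopNilp ψ) (h : convExp φ hφ = convExp ψ hψ) : φ = ψ := by
  have hc : constantCoeff (PowerSeries.exp k - 1) = 0 := by simp
  have h1 : TopNilp (convExp φ hφ - 1) := convExp_sub_one φ hφ ▸ hφ.evalSeries hc
  have h2 : TopNilp (convExp ψ hψ - 1) := h ▸ h1
  rw [← convLog_convExp φ hφ h1, ← convLog_convExp ψ hψ h2]
  exact evalSeries_congr _ (by rw [h]) _ _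

end MVAlgebra

namespace GrSym

variable {k : Type u} [Field k]

section Words

variable {U : ℤ → Type v} [∀ i, AddCommGroup (U i)] [∀ i, Module k (U i)]

/-- Permuting the letters of a word changes it by a scalar (a sign). -/
theorem exists_word_eq_smul_of_perm {l l' : List (Σ i, U i)} (h : l.Perm l') :
    ∃ c : k, (word l : GrSym k U) = c • word l' := by
  induction h with
  | nil => exact ⟨1, (one_smul _ _).symm⟩
  | cons p _ ih =>
    obtain ⟨c, hc⟩ := ih
    exact ⟨c, by rw [word_cons, word_cons, hc, mul_smul_comm]⟩
  | swap p q l =>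
    refine ⟨ksign k (q.1 * p.1), ?_⟩
    rw [word_cons, word_cons, word_cons, word_cons, ← mul_assoc, ← mul_assoc, ι_comm,
      smul_mul_assoc, units_smul_eq (k := k)]
    rfl
  | trans _ _ ih ih' =>
    obtain ⟨c, hc⟩ := ih
    obtain ⟨d, hd⟩ := ih'
    exact ⟨c * d, by rw [hc, hd, smul_smul]⟩

theorem mul_mem_symPow {m n : ℕ} {a b : GrSym k U} (ha : a ∈ symPow k U m)
    (hb : b ∈ symPow k U n) : a * b ∈ symPow k U (m + n) := by
  have h := Submodule.mul_mem_mul ha hb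
  rw [symPow, symPow, Submodule.span_mul_span] at h
  refine Submodule.span_le.mpr ?_ h
  rintro _ ⟨_, ⟨l, rfl, rfl⟩, _, ⟨l', rfl, rfl⟩, rfl⟩
  exact Submodule.subset_span ⟨l ++ l', List.length_append, (word_append l l').symm⟩

theorem one_mem_symPow : (1 : GrSym k U) ∈ symPow k U 0 :=
  Submodule.subset_span ⟨[], rfl, rfl⟩

/-- Maps into a graded commutative algebra which preserve degrees satisfy the Koszul rule. -/
theorem koszulCommute_mulGen {B : MVAlg.{u, w} k} {φ : WithConv (GrSym k U →ₗ[k] B.V⟦X⟧)}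
    (hφ : ∀ d : ℤ, ∀ v ∈ deg k U d, ∀ n : ℕ, coeff n (φ v) ∈ B.deg d) (d : ℤ) (x : U d) :
    KoszulCommute d (precomp φ (mulGen k d x)) φ := by
  intro i j a ha b hb
  ext n
  rw [PowerSeries.coeff_smul, coeff_mul, coeff_mul, ← Finset.Nat.sum_antidiagonal_swap,
    Finset.smul_sum]
  refine Finset.sum_congr rfl fun q _ => ?_
  rw [Prod.fst_swap, Prod.snd_swap, B.mul_comm (j + d) i _ ?_ _ (hφ i a ha _),
    units_smul_eq (k := k)]
  · rfl
  · rw [add_comm j d]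
    exact hφ (d + j) _ (SetLike.mul_mem_graded (ι_mem_deg d x) hb) _

end Words

variable {W : ℤ → Type v} [∀ i, AddCommGroup (W i)] [∀ i, Module k (W i)]

variable (k) in
/-- A word in generators of `S(W)`, regarded as a single generator of `S(S(W))`. -/
def block (l : List (Σ i, W i)) : Σ d, Pieces k W d := ⟨wordDeg l, ⟨word l, word_mem_deg l⟩⟩

theorem word_block_cons (l : List (Σ i, W i)) (L : List (List (Σ i, W i))) :
    (word ((l :: L).map (block k)) : GrSym k (Pieces k W)) =
      emb k W (word l) * word (L.map (block k)) := by
  rw [List.map_cons, word_cons, emb_of_mem (word_mem_deg l)]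
  rfl

/-- The symmetric powers of `S(W)` are spanned by the products of words. -/
theorem symPow_le_span_block (m : ℕ) : symPow k (Pieces k W) m ≤ Submodule.span k
    {s | ∃ L : List (List (Σ i, W i)), L.length = m ∧ s = word (L.map (block k))} := by
  refine Submodule.span_le.mpr ?_
  rintro _ ⟨l, rfl, rfl⟩
  induction l with
  | nil => exact Submodule.subset_span ⟨[], rfl, rfl⟩
  | cons p l ih =>
    have h1 : ι (Pieces k W) p.1 p.2 = emb k W (p.2 : GrSym k W) := (emb_of_mem p.2.2).symm
    rw [word_cons, h1, List.length_cons]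
    generalize (p.2 : GrSym k W) = a
    have ha : a ∈ Submodule.span k (Set.range (word : List (Σ i, W i) → GrSym k W)) := by
      rw [span_words]
      trivial
    induction ha using Submodule.span_induction with
    | zero => rw [map_zero, zero_mul]; exact zero_mem _
    | add a b _ _ ha hb => rw [map_add, add_mul]; exact add_mem ha hb
    | smul c a _ ha => rw [map_smul, smul_mul_assoc]; exact Submodule.smul_mem _ _ ha
    | mem a ha =>
      obtain ⟨l', rfl⟩ := ha
      generalize (word l : GrSym k (Pieces k W)) = s at ih ⊢
      change s ∈ Submodule.span k _ at ih
      induction ih using Submodule.span_induction with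
      | zero => rw [mul_zero]; exact zero_mem _
      | add a b _ _ ha hb => rw [mul_add]; exact add_mem ha hb
      | smul c a _ ha => rw [mul_smul_comm]; exact Submodule.smul_mem _ _ ha
      | mem s hs =>
        obtain ⟨L, hL, rfl⟩ := hs
        exact Submodule.subset_span ⟨l' :: L, by rw [List.length_cons, hL],
          (word_block_cons l' L).symm⟩

/-- A product of one-letter blocks comes from a word in `S(W)`. -/
theorem exists_word_block_eq_embAlgHom (L : List (List (Σ i, W i))) (hL : ∀ l ∈ L, l.length = 1) :
    ∃ l : List (Σ i, W i), l.length = L.length ∧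
      (word (L.map (block k)) : GrSym k (Pieces k W)) = embAlgHom k W (word l) := by
  induction L with
  | nil => exact ⟨[], rfl, (map_one (embAlgHom k W)).symm⟩
  | cons l L ih =>
    obtain ⟨l', hl', h⟩ := ih fun l hl => hL l (List.mem_cons_of_mem _ hl)
    obtain ⟨p, rfl⟩ := List.length_eq_one_iff.mp (hL l List.mem_cons_self)
    refine ⟨p :: l', by rw [List.length_cons, List.length_cons, hl'], ?_⟩
    rw [word_block_cons, h, word_cons p l', map_mul, embAlgHom_ι, ← word_single]

section EmbAlgHom

variable {T : Type w} [Ring T] [Algebra k T]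

theorem precomp_embAlgHom_pow (φ : WithConv (GrSym k (Pieces k W) →ₗ[k] T⟦X⟧)) (m : ℕ) :
    precomp (φ ^ m) (embAlgHom k W).toLinearMap =
      precomp φ (embAlgHom k W).toLinearMap ^ m := by
  induction m with
  | zero =>
    ext1
    refine LinearMap.ext fun s => ?_
    change (φ ^ 0) (embAlgHom k W s) = _
    rw [pow_zero, pow_zero, LinearMap.convOne_apply, LinearMap.convOne_apply, counit_def,
      counit_def, counit_embAlgHom]
  | succ m ih =>
    rw [pow_succ, pow_succ, ← ih]
    ext1
    refine LinearMap.ext fun s => ?_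
    change (φ ^ m * φ) (embAlgHom k W s) = _
    rw [LinearMap.convMul_apply, LinearMap.convMul_apply, comul_def, comul_def, comulₗ_embAlgHom]
    induction comulₗ k W s with
    | zero => simp only [map_zero]
    | add a b ha hb => simp only [map_add, ha, hb]
    | tmul a b => rfl

theorem topNilp_precomp_embAlgHom {φ : WithConv (GrSym k (Pieces k W) →ₗ[k] T⟦X⟧)}
    (h : TopNilp φ) : TopNilp (precomp φ (embAlgHom k W).toLinearMap) := by
  intro v N
  obtain ⟨K, hK⟩ := h (embAlgHom k W v) N
  exact ⟨K, fun m hm n hn => by rw [← precomp_embAlgHom_pow]; exact hK m hm n hn⟩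

theorem precomp_embAlgHom_convExp [CharZero k]
    {φ : WithConv (GrSym k (Pieces k W) →ₗ[k] T⟦X⟧)} (h : TopNilp φ) :
    precomp (convExp φ h) (embAlgHom k W).toLinearMap =
      convExp (precomp φ (embAlgHom k W).toLinearMap) (topNilp_precomp_embAlgHom h) := by
  ext v n
  refine (coeff_evalSeries _ φ h (embAlgHom k W v) n).trans ?_
  rw [convExp, coeff_evalSeries]
  refine finsum_congr fun m => ?_
  rw [← precomp_embAlgHom_pow]
  rfl

end EmbAlgHom

section Cumulant

theorem muHat_ι_mul (d : ℤ) (x : Pieces k W d) (s : GrSym k (Pieces k W)) :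
    muHat k W (ι (Pieces k W) d x * s) = x * muHat k W s := by
  rw [map_mul]
  congr 1
  exact lift_ι (U := Pieces k W) _ _ d x

variable [CharZero k] {B : MVAlg.{u, w} k}

/-- `κ : S(S(W)) → B⟦X⟧` is the cumulant of `F : S(W) → B⟦X⟧`: the logarithm of the map
`a₁ • ⋯ • aₙ ↦ F(a₁ ⋯ aₙ)`. -/
structure IsCumulant (κ : WithConv (GrSym k (Pieces k W) →ₗ[k] B.V⟦X⟧))
    (F : WithConv (GrSym k W →ₗ[k] B.V⟦X⟧)) : Prop where
  deg : ∀ d : ℤ, ∀ v ∈ deg k (Pieces k W) d, ∀ n : ℕ, coeff n (κ v) ∈ B.deg d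
  topNilp : TopNilp κ
  exp_eq : convExp κ topNilp = precomp F (muHat k W).toLinearMap

variable {κ : WithConv (GrSym k (Pieces k W) →ₗ[k] B.V⟦X⟧)}
  {F : WithConv (GrSym k W →ₗ[k] B.V⟦X⟧)}

theorem IsCumulant.precomp_mulGen (h : IsCumulant κ F) (d : ℤ) (x : Pieces k W d) :
    precomp (precomp F (muHat k W).toLinearMap) (mulGen k d x) =
      precomp κ (mulGen k d x) * precomp F (muHat k W).toLinearMap := by
  rw [← h.exp_eq]
  exact precomp_mulGen_convExp h.topNilp (koszulCommute_mulGen h.deg d x)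

theorem IsCumulant.isUnit (h : IsCumulant κ F) : IsUnit (precomp F (muHat k W).toLinearMap) :=
  h.exp_eq ▸ isUnit_convExp κ h.topNilp

/-- A cumulant with `1 ∈ S(W)` among its arguments is trivial. -/
theorem IsCumulant.apply_one_mul (h : IsCumulant κ F) (s : GrSym k (Pieces k W)) :
    κ (emb k W 1 * s) = algebraMap k B.V⟦X⟧ (counitAlgHom k (Pieces k W) s) := by
  have h1 : precomp κ (mulGen k 0 (⟨1, SetLike.one_mem_graded _⟩ : Pieces k W 0)) = 1 := by
    refine h.isUnit.mul_right_cancel ?_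
    rw [← h.precomp_mulGen, one_mul]
    ext1
    refine LinearMap.ext fun s => ?_
    change F (muHat k W (ι (Pieces k W) 0 _ * s)) = F (muHat k W s)
    rw [muHat_ι_mul, one_mul]
  rw [emb_of_mem (SetLike.one_mem_graded (GrSym.deg k W))]
  exact congrArg (fun φ : WithConv (GrSym k (Pieces k W) →ₗ[k] B.V⟦X⟧) => φ s) h1

/-- The cumulant with a product `a b` among its arguments is the cumulant with `a` and `b` as
separate arguments, plus products of two cumulants which separate `a` from `b`. -/
theorem IsCumulant.apply_mul_mul (h : IsCumulant κ F) {i j : ℤ} {a b : GrSym k W}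
    (ha : a ∈ GrSym.deg k W i) (hb : b ∈ GrSym.deg k W j) (s : GrSym k (Pieces k W)) :
    κ (emb k W (a * b) * s) = κ (emb k W a * (emb k W b * s)) +
      (precomp (precomp κ (mulGen k i (⟨a, ha⟩ : Pieces k W i)))
        (par k (Pieces k W) j).toLinearMap *
        precomp κ (mulGen k j (⟨b, hb⟩ : Pieces k W j))) s := by
  have h1 : precomp κ (mulGen k (i + j) (⟨a * b, SetLike.mul_mem_graded ha hb⟩ :
        Pieces k W (i + j))) =
      precomp (precomp κ (mulGen k i (⟨a, ha⟩ : Pieces k W i)))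
        (mulGen k j (⟨b, hb⟩ : Pieces k W j)) +
      precomp (precomp κ (mulGen k i (⟨a, ha⟩ : Pieces k W i)))
        (par k (Pieces k W) j).toLinearMap * precomp κ (mulGen k j (⟨b, hb⟩ : Pieces k W j)) := by
    refine h.isUnit.mul_right_cancel ?_
    rw [← h.precomp_mulGen, add_mul, mul_assoc _ (precomp κ _) (precomp F _),
      ← h.precomp_mulGen j, ← precomp_mulGen_mul, ← h.precomp_mulGen]
    ext1
    refine LinearMap.ext fun s => ?_
    change F (muHat k W (ι (Pieces k W) (i + j) _ * s)) =
      F (muHat k W (ι (Pieces k W) i _ * (ι (Pieces k W) j _ * s)))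
    rw [muHat_ι_mul, muHat_ι_mul, muHat_ι_mul, mul_assoc]
  rw [emb_of_mem (SetLike.mul_mem_graded ha hb), emb_of_mem ha, emb_of_mem hb]
  exact congrArg (fun φ : WithConv (GrSym k (Pieces k W) →ₗ[k] B.V⟦X⟧) => φ s) h1

/-- On products of generators of `W`, the cumulant of `exp f` is `f`. -/
theorem IsCumulant.precomp_embAlgHom {f : WithConv (GrSym k W →ₗ[k] B.V⟦X⟧)} {hf : TopNilp f}
    (h : IsCumulant κ (convExp f hf)) : precomp κ (embAlgHom k W).toLinearMap = f := by
  refine convExp_injective (topNilp_precomp_embAlgHom h.topNilp) hf ?_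
  rw [← precomp_embAlgHom_convExp h.topNilp, h.exp_eq]
  ext1
  refine LinearMap.ext fun s => ?_
  change convExp f hf (muHat k W (embAlgHom k W s)) = _
  rw [muHat_embAlgHom]

/-- The `n`-th symmetric power is mapped into `X ^ (n - 1)`: the weight condition of
`IBL_∞`-morphisms. -/
def HasWeight {U : ℤ → Type v} [∀ i, AddCommGroup (U i)] [∀ i, Module k (U i)] {T : Type w}
    [Ring T] [Algebra k T] (φ : WithConv (GrSym k U →ₗ[k] T⟦X⟧)) : Prop :=
  ∀ j n : ℕ, j + 1 < n → ∀ x ∈ symPow k U n, coeff j (φ x) = 0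

/-- The weight condition for the cumulant of `exp f`, on products of words. -/
theorem IsCumulant.coeff_word_block {f : WithConv (GrSym k W →ₗ[k] B.V⟦X⟧)} {hf : TopNilp f}
    (h : IsCumulant κ (convExp f hf)) (hw : HasWeight f) (L : List (List (Σ i, W i))) (j : ℕ)
    (hj : j + 1 < L.length) : coeff j (κ (word (L.map (block k)))) = 0 := by
  -- Induction on the excess of the total length of the blocks over their number: splitting off a
  -- letter of a block decreases it in all the terms of `IsCumulant.apply_mul_mul`.
  obtain ⟨e, he⟩ : ∃ e, e = (L.map fun l => l.length - 1).sum := ⟨_, rfl⟩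
  induction e using Nat.strong_induction_on generalizing L j with
  | _ e ih =>
  by_cases hall : ∀ l ∈ L, l.length = 1
  · obtain ⟨l, hl, hL⟩ := exists_word_block_eq_embAlgHom (k := k) L hall
    rw [hL]
    refine (congrArg (fun φ : WithConv (GrSym k W →ₗ[k] B.V⟦X⟧) => coeff j (φ (word l)))
      h.precomp_embAlgHom).trans ?_
    exact hw j L.length hj _ (Submodule.subset_span ⟨l, hl, rfl⟩)
  · push Not at hall
    obtain ⟨l, hl, hl1⟩ := hall
    obtain ⟨s, t, rfl⟩ := List.append_of_mem hl
    have hp : (s ++ l :: t).Perm (l :: (s ++ t)) := List.perm_middle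
    obtain ⟨c, hc⟩ := exists_word_eq_smul_of_perm (k := k) (hp.map (block k))
    rw [hc, map_smul, PowerSeries.coeff_smul]
    rw [(hp.map fun l => l.length - 1).sum_eq] at he
    rw [hp.length_eq] at hj
    generalize s ++ t = L at he hj
    rw [List.length_cons] at hj
    rw [List.map_cons, List.sum_cons] at he
    suffices hs : coeff j (κ (word ((l :: L).map (block k)))) = 0 by rw [hs, smul_zero]
    rw [word_block_cons]
    cases l with
    | nil =>
      -- An empty block is the unit of `S(W)`.
      rw [word_nil, h.apply_one_mul]
      cases L with
      | nil => simp at hj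
      | cons l' L =>
        rw [word_block_cons, map_mul, counit_emb, zero_mul, map_zero, map_zero]
    | cons p l =>
      rw [List.length_cons] at hl1 he
      rw [word_cons, h.apply_mul_mul (ι_mem_deg p.1 p.2) (word_mem_deg l), map_add]
      have h1 : coeff j (κ (emb k W (ι W p.1 p.2) *
          (emb k W (word l) * word (L.map (block k))))) = 0 := by
        rw [← word_block_cons, ← word_single, ← word_block_cons]
        refine ih _ ?_ ([p] :: l :: L) j ?_ rfl
        · simp only [List.map_cons, List.sum_cons, List.length_cons, List.length_nil]
          omega
        · simp only [List.length_cons]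
          omega
      rw [h1, zero_add]
      refine coeff_conv_mul_word _ _ _ _ _ fun L₁ L₂ hL => ?_
      have hlen := hL.length_eq
      rw [List.length_append] at hlen
      have hsum := (hL.map fun l => l.length - 1).sum_eq
      rw [List.map_append, List.sum_append] at hsum
      rw [coeff_mul]
      refine Finset.sum_eq_zero fun q hq => ?_
      rw [Finset.HasAntidiagonal.mem_antidiagonal] at hq
      -- The two factors have `L.length + 2` arguments in total, so that one of them has too many.
      rcases (by omega : q.1 < L₁.length ∨ q.2 < L₂.length) with hq' | hq'
      · have h2 : coeff q.1 (κ (word (([p] :: L₁).map (block k)))) = 0 := by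
          refine ih _ ?_ ([p] :: L₁) q.1 ?_ rfl
          · simp only [List.map_cons, List.sum_cons, List.length_cons, List.length_nil]
            omega
          · rw [List.length_cons]
            omega
        rw [word_block_cons, word_single, emb_of_mem (ι_mem_deg p.1 p.2)] at h2
        have h3 : coeff q.1 (κ (ι (Pieces k W) p.1 ⟨_, ι_mem_deg p.1 p.2⟩ *
            par k (Pieces k W) (wordDeg l) (word (L₁.map (block k))))) = 0 := by
          rw [par_word, mul_smul_comm, map_smul, PowerSeries.coeff_smul, h2, smul_zero]
        exact (congrArg (· * _) h3).trans (zero_mul _)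
      · have h2 : coeff q.2 (κ (word ((l :: L₂).map (block k)))) = 0 := by
          refine ih _ ?_ (l :: L₂) q.2 ?_ rfl
          · simp only [List.map_cons, List.sum_cons]
            omega
          · rw [List.length_cons]
            omega
        rw [word_block_cons, emb_of_mem (word_mem_deg l)] at h2
        exact (congrArg (_ * ·) h2).trans (mul_zero _)

theorem IsCumulant.hasWeight {f : WithConv (GrSym k W →ₗ[k] B.V⟦X⟧)} {hf : TopNilp f}
    (h : IsCumulant κ (convExp f hf)) (hw : HasWeight f) : HasWeight κ := by
  intro j n hj x hx
  have h1 : Submodule.span k {s | ∃ L : List (List (Σ i, W i)), L.length = n ∧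
      s = word (L.map (block k))} ≤ LinearMap.ker (coeffMap κ j) := by
    rw [Submodule.span_le]
    rintro _ ⟨L, hL, rfl⟩
    exact h.coeff_word_block hw L j (hL ▸ hj)
  exact h1 (symPow_le_span_block n hx)

end Cumulant

end GrSym


/-! ### The weight condition for compositions and identities -/

namespace GrSym

variable {k : Type u} [Field k] {U : ℤ → Type v} [∀ i, AddCommGroup (U i)] [∀ i, Module k (U i)]
  {W : ℤ → Type v} [∀ i, AddCommGroup (W i)] [∀ i, Module k (W i)]
  {B : MVAlg.{u, max u v} k}

/-- The cumulant exists as soon as `F` is a map of degree zero with `F(1) ≡ 1` modulo `X`. -/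
theorem exists_isCumulant [CharZero k] {F : WithConv (GrSym k W →ₗ[k] B.V⟦X⟧)}
    (hF : ∀ d : ℤ, ∀ v ∈ deg k W d, ∀ n : ℕ, coeff n (F v) ∈ B.deg d)
    (h1 : coeff 0 (F 1) = 1) : ∃ κ, IsCumulant κ F := by
  let E : WithConv (GrSym k (Pieces k W) →ₗ[k] B.V⟦X⟧) := precomp F (muHat k W).toLinearMap
  have hE : ∀ d : ℤ, ∀ v ∈ deg k (Pieces k W) d, ∀ n : ℕ, coeff n ((E - 1) v) ∈ B.deg d := by
    intro d v hv n
    rw [ofConv_sub, LinearMap.sub_apply, map_sub]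
    exact sub_mem (hF d _ (muHat_mem hv) n)
      (MVAlg.convDegZero_one (A := mv k (Pieces k W)) (B := B) d v hv n)
  have hE1 : coeff 0 ((E - 1) 1) = 0 := by
    have h2 : E 1 = F 1 := congrArg F (map_one (muHat k W))
    rw [ofConv_sub, LinearMap.sub_apply, map_sub, h2, h1, LinearMap.convOne_apply, counit_one,
      map_one (algebraMap k B.V⟦X⟧), coeff_zero_one, sub_self]
  have hN : TopNilp (E - 1) := topNilp_of_deg hE hE1
  have hl : TopNilp (convLog E hN) := hN.evalSeries constantCoeff_log
  exact ⟨convLog E hN,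
    MVAlg.ConvDegZero.evalSeries (A := mv k (Pieces k W)) (B := B) hE (PowerSeries.log k) hN,
    hl, convExp_convLog E hN hl⟩

section ExpEmb

variable {g : WithConv (GrSym k U →ₗ[k] (GrSym k W)⟦X⟧)}

theorem coeff_emb_pow_mem_symPow (b m : ℕ) (v : GrSym k U) :
    coeff b ((postcomp (emb k W) g ^ m) v) ∈ symPow k (Pieces k W) m := by
  induction m generalizing b v with
  | zero =>
    rw [pow_zero, LinearMap.convOne_apply, PowerSeries.algebraMap_apply, coeff_C]
    split_ifs
    · rw [Algebra.algebraMap_eq_smul_one]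
      exact Submodule.smul_mem _ _ one_mem_symPow
    · exact zero_mem _
  | succ m ih =>
    rw [pow_succ, coeff_conv_mul _ _ v b (Coalgebra.Repr.arbitrary k v)]
    refine sum_mem fun i _ => sum_mem fun q _ => mul_mem_symPow (ih _ _) ?_
    rw [coeff_postcomp]
    exact emb_mem_symPow _

/-- Each factor of the `m`-th convolution power sends `Sⁿ(U)` into the multiples of `X ^ (n - 1)`,
hence the power sends it into those of `X ^ (n - m)`. -/
theorem coeff_emb_pow_eq_zero (hg : HasWeight g) (b m n : ℕ) (h : b + m < n) (v : GrSym k U)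
    (hv : v ∈ symPow k U n) : coeff b ((postcomp (emb k W) g ^ m) v) = 0 := by
  suffices hs : symPow k U n ≤ LinearMap.ker (coeffMap (postcomp (emb k W) g ^ m) b) from hs hv
  rw [symPow, Submodule.span_le]
  rintro _ ⟨l, rfl, rfl⟩
  change coeff b ((postcomp (emb k W) g ^ m) (word l)) = 0
  clear hv
  induction m generalizing b l with
  | zero =>
    rw [pow_zero, LinearMap.convOne_apply, counit_def]
    cases l with
    | nil => simp at h
    | cons p l => rw [word_cons, map_mul, counitAlgHom_ι, zero_mul, map_zero, map_zero]
  | succ m ih =>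
    rw [pow_succ, ← List.map_id l]
    refine coeff_conv_mul_word _ _ _ _ _ fun l₁ l₂ hl => ?_
    have hlen := hl.length_eq
    rw [List.length_append] at hlen
    rw [List.map_id, List.map_id, coeff_mul]
    refine Finset.sum_eq_zero fun q hq => ?_
    rw [Finset.HasAntidiagonal.mem_antidiagonal] at hq
    rcases (by omega : q.1 + m < l₁.length ∨ q.2 + 1 < l₂.length) with hq' | hq'
    · rw [ih q.1 l₁ hq', zero_mul]
    · rw [coeff_postcomp, hg q.2 l₂.length hq' _ (Submodule.subset_span ⟨l₂, rfl, rfl⟩), map_zero,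
        mul_zero]

end ExpEmb

/-- The weight condition is stable under the composition `log (exp f ∘ exp g)`. -/
theorem HasWeight.of_convExp_eq_compHat [CharZero k]
    {f : WithConv (GrSym k W →ₗ[k] B.V⟦X⟧)}
    {g : WithConv (GrSym k U →ₗ[k] (GrSym k W)⟦X⟧)} {h : WithConv (GrSym k U →ₗ[k] B.V⟦X⟧)}
    (hf : ∀ d : ℤ, ∀ v ∈ deg k W d, ∀ n : ℕ, coeff n (f v) ∈ B.deg d)
    (hf1 : coeff 0 (f 1) = 0)
    (hg : ∀ d : ℤ, ∀ v ∈ deg k U d, ∀ n : ℕ, coeff n (g v) ∈ deg k W d)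
    (hg1 : coeff 0 (g 1) = 0) (hfN : TopNilp f) (hgN : TopNilp g) (hhN : TopNilp h)
    (hcomp : convExp h hhN = compHat (convExp f hfN) (convExp g hgN))
    (hfw : HasWeight f) (hgw : HasWeight g) : HasWeight h := by
  have hF1 : coeff 0 (convExp f hfN 1) = 1 :=
    (MVAlg.evalSeries_map_one (A := mv k W) (B := B) hf1 _ hfN).trans (by simp)
  obtain ⟨κ, hκ⟩ := exists_isCumulant
    (MVAlg.ConvDegZero.evalSeries (A := mv k W) (B := B) hf (PowerSeries.exp k) hfN) hF1
  have hN : TopNilp (postcomp (emb k W) g) := topNilp_emb hg hg1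
  let θ := convExp (postcomp (emb k W) g) hN
  have hθ : IsCompletedCoalgHom θ := isCompletedCoalgHom_convExp_emb hg hN
  have hmu : postcomp (muHat k W).toLinearMap θ = convExp g hgN := by
    rw [postcomp_convExp (muHat k W) hN]
    refine convExp_congr ?_ _ _
    ext v n
    rw [coeff_postcomp, coeff_postcomp]
    exact muHat_emb _
  have hh : h = compHat κ θ := by
    refine convExp_injective hhN (hθ.topNilp hκ.topNilp) ?_
    rw [hcomp, ← hθ.compHat_convExp hκ.topNilp, hκ.exp_eq, ← hmu]
    ext v n
    rw [coeff_compHat, coeff_compHat]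
    refine Finset.sum_congr rfl fun q _ => ?_
    rw [coeff_postcomp]
    rfl
  have hκw := hκ.hasWeight hfw
  intro j n hj x hx
  -- In `h = κ ∘ θ`, the `m`-th term of `θ` contributes at least `n - m` powers of `X`, and `κ`
  -- contributes at least `m - 1`.
  rw [hh, coeff_compHat]
  refine Finset.sum_eq_zero fun q hq => ?_
  rw [Finset.HasAntidiagonal.mem_antidiagonal] at hq
  obtain ⟨M, hM⟩ := hN x (q.2 + 1)
  rw [show coeff q.2 (θ x) = _ from
    coeff_evalSeries_eq_sum _ hN x q.2 M fun m hm => hM m hm _ (by omega), map_sum, map_sum]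
  refine Finset.sum_eq_zero fun m _ => ?_
  rw [map_smul, PowerSeries.coeff_smul]
  rcases (by omega : q.1 + 1 < m ∨ q.2 + m < n) with h' | h'
  · rw [hκw q.1 m h' _ (coeff_emb_pow_mem_symPow q.2 m x), smul_zero]
  · rw [coeff_emb_pow_eq_zero hgw q.2 m n h' x hx, map_zero, map_zero, smul_zero]

/-- The logarithm of the identity vanishes on products of at least two generators. -/
theorem HasWeight.of_convExp_eq_id [CharZero k]
    {l : WithConv (GrSym k U →ₗ[k] (GrSym k U)⟦X⟧)}
    (hl : ∀ d : ℤ, ∀ v ∈ deg k U d, ∀ n : ℕ, coeff n (l v) ∈ deg k U d) (hN : TopNilp l)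
    (hid : ∀ v, convExp l hN v = C v) : HasWeight l := by
  -- Both sides become `s ↦ u s` after multiplication by the invertible element `exp l = id`.
  have key : ∀ i (x : U i), precomp l (mulGen k i x) =
      toConv ((Coalgebra.counit (R := k) (A := GrSym k U)).smulRight
        (C (ι U i x) : (GrSym k U)⟦X⟧)) := by
    intro i x
    refine (isUnit_convExp l hN).mul_right_cancel ?_
    rw [← precomp_mulGen_convExp hN (koszulCommute_mulGen (B := mv k U) hl i x)]
    ext1
    refine LinearMap.ext fun s => ?_
    rw [conv_scalar_mul, hid, ← map_mul]
    exact hid _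
  intro j n hj x hx
  suffices hs : symPow k U n ≤ LinearMap.ker (coeffMap l j) from hs hx
  rw [symPow, Submodule.span_le]
  rintro _ ⟨w, rfl, rfl⟩
  change coeff j (l (word w)) = 0
  match w with
  | [] => simp at hj
  | [p] => simp at hj
  | p :: q :: w =>
    have h1 : l (ι U p.1 p.2 * word (q :: w)) =
        counitAlgHom k U (word (q :: w)) • (C (ι U p.1 p.2) : (GrSym k U)⟦X⟧) :=
      congrArg (fun φ : WithConv (GrSym k U →ₗ[k] (GrSym k U)⟦X⟧) => φ (word (q :: w)))
        (key p.1 p.2)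
    rw [word_cons p, h1, word_cons, map_mul, counitAlgHom_ι, zero_mul, zero_smul, map_zero]

end GrSym

/-- The weight condition suffices for an `IBL_∞`-morphism, since the normalisation on `1` is part of
the definition of `Lin⁰`. -/
theorem isIBLHom_of_hasWeight {k : Type u} [Field k] [CharZero k] {A B : IBLAlg.{u, v} k}
    (f : A.toMV ⟶ B.toMV) (hf : GrSym.HasWeight (k := k) (U := A.U) (T := GrSym k B.U)
      (MVAlg.toConvAlg (MVAlg.Hom.toLin0 f).toLin)) : IsIBLHom f where
  map_one := by
    have h := (MVAlg.Hom.toLin0 f).map_unit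
    rwa [← MVAlg.toConvAlg_one_apply] at h
  map_symPow := hf

end

theorem mainTheorem2 (k : Type u) [Field k] [CharZero k] :
    (∀ A : IBLAlg.{u, v} k, IsIBLHom (A := A) (B := A) (𝟙 A.toMV)) ∧
    (∀ (A B D : IBLAlg.{u, v} k) (g : A.toMV ⟶ B.toMV) (f : B.toMV ⟶ D.toMV),
      IsIBLHom g → IsIBLHom f →
        MVAlg.Hom.toLin0 (g ≫ f) =
          MVAlg.log ((MVAlg.exp (MVAlg.Hom.toLin0 f)).comp (MVAlg.exp (MVAlg.Hom.toLin0 g))) ∧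
        IsIBLHom (A := A) (B := D) (g ≫ f)) := by
  refine ⟨fun A => isIBLHom_of_hasWeight _ ?_, fun A B D g f hg hf =>
    ⟨rfl, isIBLHom_of_hasWeight _ ?_⟩⟩
  · let l : MVAlg.Lin0 A.toMV A.toMV := MVAlg.Hom.toLin0 (𝟙 A.toMV)
    refine GrSym.HasWeight.of_convExp_eq_id (k := k) (U := A.U) l.degZero l.topNilp fun v => ?_
    have h := congrArg (fun φ : MVAlg.Lin1 A.toMV A.toMV => φ.toLin (C v))
      (MVAlg.Hom.exp_id A.toMV)
    exact (MVAlg.ofConvAlg_C (A := A.toMV) (B := A.toMV) _ v).symm.trans h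
  · let f₀ : MVAlg.Lin0 B.toMV D.toMV := MVAlg.Hom.toLin0 f
    let g₀ : MVAlg.Lin0 A.toMV B.toMV := MVAlg.Hom.toLin0 g
    let h₀ : MVAlg.Lin0 A.toMV D.toMV := MVAlg.Hom.toLin0 (g ≫ f)
    refine GrSym.HasWeight.of_convExp_eq_compHat (k := k) (U := A.U) (W := B.U) (B := D.toMV)
      (f := MVAlg.toConvAlg f₀.toLin) (g := MVAlg.toConvAlg g₀.toLin) f₀.degZero ?_ g₀.degZero ?_
      f₀.topNilp g₀.topNilp h₀.topNilp ?_ hf.map_symPow hg.map_symPow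
    · exact (congrArg (coeff 0) (MVAlg.toConvAlg_one_apply f₀.toLin)).trans f₀.map_unit
    · exact (congrArg (coeff 0) (MVAlg.toConvAlg_one_apply g₀.toLin)).trans g₀.map_unit
    · have h := congrArg (fun φ : MVAlg.Lin1 A.toMV D.toMV => MVAlg.toConvAlg φ.toLin)
        (MVAlg.Hom.exp_diamond f g)
      exact (MVAlg.toConvAlg_ofConvAlg _).symm.trans h
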